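/- For $s>0$ let $B_s\subset\mathbb{R}^n$ be the open ball of radius $s$ centered at the origin. For every $n$ there exists a constant $C=C(n)>0$, depending only on $n$, such that the following holds for every $r>0$. Let $u: B_{\sqrt{2n+1}\,r}\times[0,r^2]\to\mathbb{R}$ be a smooth function whose graph flows by mean curvature, i.e. $$u_t=(1+|du|^2)^{1/2}\,\mathrm{div}\left(\frac{du}{(1+|du|^2)^{1/2}}\right)\quad\text{on } B_{\sqrt{2n+1}\,r}\times[0,r^2],$$ where $du$ and $\mathrm{div}$ are the gradient and the divergence in $\mathbb{R}^n$ (and $u_t$ is one-sided at $t=0$ and $t=r^2$). Then the area of the graph of $u(\cdot,r^2)$ over $B_{r/2}$ satisfies $$\int_{B_{r/2}}(1+|du|^2)^{1/2}(x,r^2)\,dx\le C\,r^n\left(1+r^{-1}\|u(\cdot,0)\|_\infty\right)^2,$$ where $\|u(\cdot,0)\|_\infty=\sup_{B_{\sqrt{2n+1}\,r}}|u(\cdot,0)|$ (the bound being void if this supremum is infinite). -/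

import Mathlib

open scoped ContDiff

noncomputable section

/-- The volume element `v = (1 + |dw|²)^{1/2}` of the graph of `w : ℝⁿ → ℝ`. -/
def volumeElement {n : ℕ} (w : EuclideanSpace ℝ (Fin n) → ℝ) (x : EuclideanSpace ℝ (Fin n)) : ℝ :=
  √(1 + ‖gradient w x‖ ^ 2)

/-- The Euclidean divergence `∑ᵢ ∂ᵢ Fᵢ` of a vector field `F` on `ℝⁿ`. -/
def divergence {n : ℕ} (F : EuclideanSpace ℝ (Fin n) → EuclideanSpace ℝ (Fin n))
    (x : EuclideanSpace ℝ (Fin n)) : ℝ :=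
  ∑ i : Fin n, (fderiv ℝ F x (EuclideanSpace.single i 1)) i

/-- The graph of `u : B_ρ × [0, T] → ℝ` flows by mean curvature, where `B_ρ` is the open ball of
radius `ρ` in `ℝⁿ` centered at the origin: `u` is smooth on `B_ρ × [0, T]` (up to the initial and
final times) and satisfies `u_t = (1 + |du|²)^{1/2} div (du / (1 + |du|²)^{1/2})` there. At `t = 0`
and `t = T` the time derivative is one-sided. The values of `u` outside `B_ρ × [0, T]` play no
role. -/
structure GraphFlowsByMeanCurvature {n : ℕ} (u : EuclideanSpace ℝ (Fin n) → ℝ → ℝ)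
    (ρ T : ℝ) : Prop where
  smooth : ContDiffOn ℝ ∞ (fun p : EuclideanSpace ℝ (Fin n) × ℝ => u p.1 p.2)
    (Metric.ball 0 ρ ×ˢ Set.Icc 0 T)
  flow : ∀ x ∈ Metric.ball (0 : EuclideanSpace ℝ (Fin n)) ρ, ∀ t ∈ Set.Icc 0 T,
    derivWithin (fun s => u x s) (Set.Icc 0 T) t =
      volumeElement (fun y => u y t) x *
        divergence (fun y => (volumeElement (fun z => u z t) y)⁻¹ • gradient (fun z => u z t) y) x

/-- The `n`-dimensional area `∫_Ω (1 + |dw|²)^{1/2} dx` of the graph of `w` over `Ω ⊆ ℝⁿ`. -/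
def graphArea {n : ℕ} (w : EuclideanSpace ℝ (Fin n) → ℝ) (Ω : Set (EuclideanSpace ℝ (Fin n))) :
    ENNReal :=
  ∫⁻ x in Ω, ENNReal.ofReal (volumeElement w x)

/-- The sup norm of `w` over `Ω`, possibly infinite. -/
def supNorm {n : ℕ} (w : EuclideanSpace ℝ (Fin n) → ℝ) (Ω : Set (EuclideanSpace ℝ (Fin n))) :
    ENNReal :=
  ⨆ x ∈ Ω, ENNReal.ofReal |w x|

end

/-! Write `v = √(1 + |du|²)`, `N = du / v` and `φ = (ρ² - |x|² - 2nt)₊`, with `ρ` slightly below the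
radius of the given ball. The proof compares the weighted area `A(t) = ∫ φ³ v` with `B(t) = ∫ φ³
u_t² / v`, where `u_t = v div N`, so that `B = ∫ φ³ v (div N)²`.

The weight is a subsolution of the heat equation on the moving graph, so the weighted area decreases
at least at the rate of its curvature term: `A' ≤ -B` (`localized_first_variation`,
`exists_hasDerivAt_localizedArea`).

Conversely, curvature controls area. Since `⟨du, N⟩ = v - 1/v`, integrating `div (u φ³ N)` bounds
`A` by lower-order terms plus `∫ φ³ |u| |div N|`. Young's inequality then gives `A ≤ K + l D + B /
(2l)` for every `l > 0`, where `K` is affine and `D` quadratic in the height bound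
(`localizedArea_le`). While `A > 2K`, the best `l` yields `A² ≤ 8 D B`, hence `A' ≤ -A² / (8D)`. A
Riccati inequality forgets its initial value, so no bound on the initial area or gradient is needed
(`le_of_riccati`).

The height bound comes from the maximum principle with shrinking spheres of radius `√(R² - 2nt)` as
barriers (`sphere_barrier`, `abs_apply_le`).

The integral estimates are made for a globally smooth function agreeing with `u` near a compact set
of interior times; Fatou's lemma then reaches the final time (`graphArea_final_le`). -/

/-! ### Calculus of the divergence, the volume element and the conormal -/

theorem sum_apply_single_mul {n : ℕ} (l : EuclideanSpace ℝ (Fin n) →L[ℝ] ℝ)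
    (a : EuclideanSpace ℝ (Fin n)) : ∑ i, l (EuclideanSpace.single i 1) * a i = l a := by
  conv_rhs => rw [← (EuclideanSpace.basisFun (Fin n) ℝ).sum_repr a, map_sum]
  simp [mul_comm]

theorem divergence_of_hasFDerivAt {n : ℕ}
    {F : EuclideanSpace ℝ (Fin n) → EuclideanSpace ℝ (Fin n)}
    {F' : EuclideanSpace ℝ (Fin n) →L[ℝ] EuclideanSpace ℝ (Fin n)} {x : EuclideanSpace ℝ (Fin n)}
    (hF : HasFDerivAt F F' x) : divergence F x = ∑ i, (F' (EuclideanSpace.single i 1)) i := by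
  rw [divergence, hF.fderiv]

theorem divergence_smul {n : ℕ} {g : EuclideanSpace ℝ (Fin n) → ℝ}
    {F : EuclideanSpace ℝ (Fin n) → EuclideanSpace ℝ (Fin n)}
    {g' : EuclideanSpace ℝ (Fin n) →L[ℝ] ℝ} {x : EuclideanSpace ℝ (Fin n)}
    (hg : HasFDerivAt g g' x) (hF : DifferentiableAt ℝ F x) :
    divergence (fun y => g y • F y) x = g x * divergence F x + g' (F x) := by
  rw [divergence_of_hasFDerivAt (hg.fun_smul hF.hasFDerivAt), divergence, ← sum_apply_single_mul g',
    Finset.mul_sum, ← Finset.sum_add_distrib]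
  simp

theorem divergence_sub {n : ℕ} {F G : EuclideanSpace ℝ (Fin n) → EuclideanSpace ℝ (Fin n)}
    {x : EuclideanSpace ℝ (Fin n)} (hF : DifferentiableAt ℝ F x) (hG : DifferentiableAt ℝ G x) :
    divergence (fun y => F y - G y) x = divergence F x - divergence G x := by
  rw [divergence_of_hasFDerivAt (hF.hasFDerivAt.fun_sub hG.hasFDerivAt), divergence, divergence,
    ← Finset.sum_sub_distrib]
  simp

theorem divergence_id {n : ℕ} (x : EuclideanSpace ℝ (Fin n)) :
    divergence (fun y => y) x = n := by
  simp [divergence]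

theorem gradient_eq_comp {n : ℕ} (w : EuclideanSpace ℝ (Fin n) → ℝ) :
    gradient w =
      fun y => (InnerProductSpace.toDual ℝ (EuclideanSpace ℝ (Fin n))).symm (fderiv ℝ w y) := rfl

theorem contDiffAt_gradient {n : ℕ} {w : EuclideanSpace ℝ (Fin n) → ℝ}
    {x : EuclideanSpace ℝ (Fin n)} {m k : ℕ∞ω} (hw : ContDiffAt ℝ m w x) (hk : k + 1 ≤ m) :
    ContDiffAt ℝ k (gradient w) x := by
  rw [gradient_eq_comp]
  exact (InnerProductSpace.toDual ℝ (EuclideanSpace ℝ (Fin n))).symm.contDiff.contDiffAt.comp x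
    (hw.fderiv_right hk)

theorem inner_fderiv_gradient {n : ℕ} {w : EuclideanSpace ℝ (Fin n) → ℝ}
    {x : EuclideanSpace ℝ (Fin n)} (hw : ContDiffAt ℝ 2 w x) (h k : EuclideanSpace ℝ (Fin n)) :
    inner ℝ (fderiv ℝ (gradient w) x h) k = fderiv ℝ (fderiv ℝ w) x h k := by
  have h1 : DifferentiableAt ℝ (fderiv ℝ w) x :=
    (hw.fderiv_right (m := 1) (by norm_num)).differentiableAt (by norm_num)
  have h2 : HasFDerivAt (gradient w) _ x :=
    ((InnerProductSpace.toDual ℝ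
      (EuclideanSpace ℝ (Fin n))).symm.toContinuousLinearEquiv.hasFDerivAt.comp x h1.hasFDerivAt)
  rw [h2.fderiv]
  simp

theorem inner_fderiv_gradient_comm {n : ℕ} {w : EuclideanSpace ℝ (Fin n) → ℝ}
    {x : EuclideanSpace ℝ (Fin n)} (hw : ContDiffAt ℝ 2 w x) (h k : EuclideanSpace ℝ (Fin n)) :
    inner ℝ (fderiv ℝ (gradient w) x h) k = inner ℝ (fderiv ℝ (gradient w) x k) h := by
  rw [inner_fderiv_gradient hw, inner_fderiv_gradient hw]
  exact hw.isSymmSndFDerivAt (by simp) h k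

theorem volumeElement_pos {n : ℕ} (w : EuclideanSpace ℝ (Fin n) → ℝ)
    (x : EuclideanSpace ℝ (Fin n)) : 0 < volumeElement w x := by
  unfold volumeElement; positivity

theorem volumeElement_sq {n : ℕ} (w : EuclideanSpace ℝ (Fin n) → ℝ)
    (x : EuclideanSpace ℝ (Fin n)) : volumeElement w x ^ 2 = 1 + ‖gradient w x‖ ^ 2 := by
  unfold volumeElement; rw [Real.sq_sqrt (by positivity)]

theorem one_le_volumeElement {n : ℕ} (w : EuclideanSpace ℝ (Fin n) → ℝ)
    (x : EuclideanSpace ℝ (Fin n)) : 1 ≤ volumeElement w x := by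
  have := volumeElement_sq w x
  have := volumeElement_pos w x
  nlinarith [sq_nonneg ‖gradient w x‖]

theorem hasFDerivAt_volumeElement {n : ℕ} {w : EuclideanSpace ℝ (Fin n) → ℝ}
    {x : EuclideanSpace ℝ (Fin n)} (hw : ContDiffAt ℝ 2 w x) :
    HasFDerivAt (volumeElement w)
      ((volumeElement w x)⁻¹ • (innerSL ℝ (gradient w x)).comp (fderiv ℝ (gradient w) x)) x := by
  have hP := ((contDiffAt_gradient hw (k := 1) (by norm_num)).differentiableAt
    (by norm_num)).hasFDerivAt
  have h := ((hP.norm_sq.const_add 1).sqrt (by positivity))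
  refine h.congr_fderiv ?_
  ext k
  simp [volumeElement]
  field_simp

theorem hasFDerivAt_inv_volumeElement {n : ℕ} {w : EuclideanSpace ℝ (Fin n) → ℝ}
    {x : EuclideanSpace ℝ (Fin n)} (hw : ContDiffAt ℝ 2 w x) :
    HasFDerivAt (fun y => (volumeElement w y)⁻¹)
      (-((volumeElement w x ^ 3)⁻¹ •
        (innerSL ℝ (gradient w x)).comp (fderiv ℝ (gradient w) x))) x := by
  have hv := volumeElement_pos w x
  have h := (hasDerivAt_inv hv.ne').comp_hasFDerivAt x (hasFDerivAt_volumeElement hw)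
  refine h.congr_fderiv ?_
  ext k
  simp
  field_simp

/-- The unit conormal `N = dw / v` of the graph of `w`. -/
noncomputable def conormal {n : ℕ} (w : EuclideanSpace ℝ (Fin n) → ℝ)
    (x : EuclideanSpace ℝ (Fin n)) : EuclideanSpace ℝ (Fin n) :=
  (volumeElement w x)⁻¹ • gradient w x

theorem differentiableAt_gradient {n : ℕ} {w : EuclideanSpace ℝ (Fin n) → ℝ}
    {x : EuclideanSpace ℝ (Fin n)} (hw : ContDiffAt ℝ 2 w x) :
    DifferentiableAt ℝ (gradient w) x :=
  (contDiffAt_gradient hw (k := 1) (by norm_num)).differentiableAt (by norm_num)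

theorem differentiableAt_conormal {n : ℕ} {w : EuclideanSpace ℝ (Fin n) → ℝ}
    {x : EuclideanSpace ℝ (Fin n)} (hw : ContDiffAt ℝ 2 w x) :
    DifferentiableAt ℝ (conormal w) x :=
  (hasFDerivAt_inv_volumeElement hw).differentiableAt.smul (differentiableAt_gradient hw)

/-- The right side is the trace of the Hessian against the inverse metric `I - dw ⊗ dw / v²`; the
maximum principle uses the equation in this nondivergence form. -/
theorem volumeElement_mul_divergence_conormal {n : ℕ} {w : EuclideanSpace ℝ (Fin n) → ℝ}
    {x : EuclideanSpace ℝ (Fin n)} (hw : ContDiffAt ℝ 2 w x) :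
    volumeElement w x * divergence (conormal w) x = divergence (gradient w) x -
      inner ℝ (fderiv ℝ (gradient w) x (gradient w x)) (gradient w x) / volumeElement w x ^ 2 := by
  have hv := volumeElement_pos w x
  rw [show conormal w = fun y => (volumeElement w y)⁻¹ • gradient w y from rfl,
    divergence_smul (hasFDerivAt_inv_volumeElement hw) (differentiableAt_gradient hw)]
  simp only [neg_apply, smul_apply,
    ContinuousLinearMap.comp_apply, innerSL_apply_apply, smul_eq_mul]
  rw [real_inner_comm]
  field_simp
  ring

/-- The field `v x - ⟨N, x⟩ dw`, which is `v` times the `g⁻¹`-dual of the position vector. -/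
noncomputable def positionField {n : ℕ} (w : EuclideanSpace ℝ (Fin n) → ℝ)
    (x : EuclideanSpace ℝ (Fin n)) : EuclideanSpace ℝ (Fin n) :=
  volumeElement w x • x - inner ℝ (gradient w x) x • conormal w x

theorem differentiableAt_positionField {n : ℕ} {w : EuclideanSpace ℝ (Fin n) → ℝ}
    {x : EuclideanSpace ℝ (Fin n)} (hw : ContDiffAt ℝ 2 w x) :
    DifferentiableAt ℝ (positionField w) x :=
  ((hasFDerivAt_volumeElement hw).differentiableAt.smul differentiableAt_id).sub
    (((differentiableAt_gradient hw).inner ℝ differentiableAt_id).smul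
      (differentiableAt_conormal hw))

/-- Both products contribute a term `⟨D²w N, x⟩`, and by symmetry of the Hessian these cancel. What
remains contains second derivatives only through `div N`, which the flow equation turns into `u_t`.
-/
theorem divergence_positionField {n : ℕ} {w : EuclideanSpace ℝ (Fin n) → ℝ}
    {x : EuclideanSpace ℝ (Fin n)} (hw : ContDiffAt ℝ 2 w x) :
    divergence (positionField w) x = volumeElement w x * (n - ‖conormal w x‖ ^ 2) -
      inner ℝ (gradient w x) x * divergence (conormal w) x := by
  have hv := volumeElement_pos w x
  have h1 := hasFDerivAt_volumeElement hw
  have h0 : DifferentiableAt ℝ (fun y : EuclideanSpace ℝ (Fin n) => y) x := differentiableAt_id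
  have h2 := (differentiableAt_gradient hw).hasFDerivAt.inner ℝ h0.hasFDerivAt
  have h3 := differentiableAt_conormal hw
  rw [show positionField w = fun y => volumeElement w y • y -
      inner ℝ (gradient w y) y • conormal w y from rfl,
    divergence_sub (h1.differentiableAt.fun_smul h0)
      (h2.differentiableAt.fun_smul h3), divergence_smul h1 h0,
    divergence_smul h2 h3, divergence_id]
  have h4 : inner ℝ (gradient w x) (fderiv ℝ (gradient w) x x) =
      volumeElement w x * inner ℝ (fderiv ℝ (gradient w) x (conormal w x)) x := by
    rw [real_inner_comm, inner_fderiv_gradient_comm hw, conormal, map_smul, real_inner_smul_left]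
    field_simp
  have h5 : inner ℝ (gradient w x) (conormal w x) = volumeElement w x * ‖conormal w x‖ ^ 2 := by
    rw [← real_inner_self_eq_norm_sq]
    nth_rewrite 2 [conormal]
    rw [real_inner_smul_left]
    field_simp
  simp [h4, h5]
  field_simp
  ring

open MeasureTheory in
theorem integral_divergence_eq_zero {n : ℕ}
    {F : EuclideanSpace ℝ (Fin n) → EuclideanSpace ℝ (Fin n)}
    (hF : ContDiff ℝ 1 F) (hc : HasCompactSupport F) :
    Integrable (divergence F) ∧ ∫ x, divergence F x = 0 := by
  have hFi : ∀ i, ContDiff ℝ 1 (fun x => F x i) := fun i =>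
    (EuclideanSpace.proj (𝕜 := ℝ) i).contDiff.comp hF
  have hci : ∀ i, HasCompactSupport (fun x => F x i) := fun i =>
    hc.comp_left (g := fun y : EuclideanSpace ℝ (Fin n) => y i) rfl
  have hd : ∀ i x, (fderiv ℝ F x (EuclideanSpace.single i 1)) i =
      fderiv ℝ (fun x => F x i) x (EuclideanSpace.single i 1) := by
    intro i x
    have h := (EuclideanSpace.proj (𝕜 := ℝ) i).hasFDerivAt.comp x
      (hF.differentiable (by norm_num) x).hasFDerivAt
    have h' : HasFDerivAt (fun x => F x i) _ x := h
    rw [h'.fderiv]; rfl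
  have hint : ∀ i, Integrable (fun x => (fderiv ℝ F x (EuclideanSpace.single i 1)) i) := by
    intro i
    simp only [hd]
    exact (((hFi i).continuous_fderiv (by norm_num)).clm_apply
      continuous_const).integrable_of_hasCompactSupport ((hci i).fderiv_apply ℝ _)
  refine ⟨integrable_finsetSum _ fun i _ => hint i, ?_⟩
  unfold divergence
  rw [integral_finsetSum _ fun i _ => hint i]
  refine Finset.sum_eq_zero fun i _ => ?_
  have := integral_mul_fderiv_eq_neg_fderiv_mul_of_integrable (μ := volume) (𝕜 := ℝ)
    (f := fun _ : EuclideanSpace ℝ (Fin n) => (1 : ℝ)) (g := fun x => F x i)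
    (v := EuclideanSpace.single i 1) (by simp)
    (by simpa only [one_mul, ← hd] using hint i)
    (by simpa using (hFi i).continuous.integrable_of_hasCompactSupport (hci i))
    (by intros; fun_prop) (fun x _ => (hFi i).differentiable (by norm_num) x)
  simpa [hd] using this

/-! ### Maximum principle and the height bound by shrinking spheres -/

/-- Evaluate the nonnegative form on `pᵢ eⱼ - pⱼ eᵢ` and sum over all `i, j`. Neither symmetry of
`A` nor a spectral decomposition is required. -/
theorem inner_apply_le_norm_sq_mul_sum {n : ℕ}
    (A : EuclideanSpace ℝ (Fin n) →L[ℝ] EuclideanSpace ℝ (Fin n))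
    (hA : ∀ h, 0 ≤ inner ℝ (A h) h) (p : EuclideanSpace ℝ (Fin n)) :
    inner ℝ (A p) p ≤ ‖p‖ ^ 2 * ∑ i, (A (EuclideanSpace.single i 1)) i := by
  have h1 : ∀ i j : Fin n, inner ℝ (A (p i • EuclideanSpace.single j 1 -
      p j • EuclideanSpace.single i 1)) (p i • EuclideanSpace.single j 1 -
      p j • EuclideanSpace.single i 1) = p i ^ 2 * (A (EuclideanSpace.single j 1)) j +
      p j ^ 2 * (A (EuclideanSpace.single i 1)) i
      - p i * p j * (A (EuclideanSpace.single j 1)) i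
      - p i * p j * (A (EuclideanSpace.single i 1)) j := by
    intro i j
    simp only [map_sub, map_smul, inner_sub_left, inner_sub_right, real_inner_smul_right,
      EuclideanSpace.inner_single_right]
    simp
    ring
  have h2 : inner ℝ (A p) p = ∑ i, ∑ j, p i * p j * (A (EuclideanSpace.single j 1)) i := by
    rw [PiLp.inner_apply]
    refine Finset.sum_congr rfl fun i _ => ?_
    have := sum_apply_single_mul ((EuclideanSpace.proj (𝕜 := ℝ) i).comp A) p
    change _ = (A p) i at this
    rw [← this, real_inner_comm, RCLike.inner_apply, conj_trivial, Finset.sum_mul]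
    exact Finset.sum_congr rfl fun j _ => by
      simp only [ContinuousLinearMap.comp_apply, PiLp.proj_apply]; ring
  have h3 : 0 ≤ ∑ i, ∑ j, (p i ^ 2 * (A (EuclideanSpace.single j 1)) j +
      p j ^ 2 * (A (EuclideanSpace.single i 1)) i
      - p i * p j * (A (EuclideanSpace.single j 1)) i
      - p i * p j * (A (EuclideanSpace.single i 1)) j) :=
    Finset.sum_nonneg fun i _ => Finset.sum_nonneg fun j _ => h1 i j ▸ hA _
  have h4 : ∑ i, ∑ j, p i * p j * (A (EuclideanSpace.single i 1)) j = inner ℝ (A p) p := by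
    rw [h2, Finset.sum_comm]
    exact Finset.sum_congr rfl fun i _ => Finset.sum_congr rfl fun j _ => by ring
  have h5 : ∑ i, ∑ j, p i ^ 2 * (A (EuclideanSpace.single j 1)) j =
      ‖p‖ ^ 2 * ∑ i, (A (EuclideanSpace.single i 1)) i := by
    rw [EuclideanSpace.real_norm_sq_eq, Finset.sum_mul_sum]
  have h6 : ∑ i, ∑ j, p j ^ 2 * (A (EuclideanSpace.single i 1)) i =
      ‖p‖ ^ 2 * ∑ i, (A (EuclideanSpace.single i 1)) i := by
    rw [← h5, Finset.sum_comm]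
  simp only [Finset.sum_add_distrib, Finset.sum_sub_distrib] at h3
  rw [h4, h5, h6, ← h2] at h3
  linarith

open Filter Topology in
-- A negative second derivative would make the point a local maximum as well, so `g` would be
-- locally constant and its second derivative zero.
theorem IsLocalMin.second_deriv_nonneg {g g' : ℝ → ℝ} {a c : ℝ} (hg : IsLocalMin g a)
    (hd : ∀ᶠ s in 𝓝 a, HasDerivAt g (g' s) s) (hd' : HasDerivAt g' c a) : 0 ≤ c := by
  by_contra! hc
  have he : deriv g =ᶠ[𝓝 a] g' := hd.mono fun s hs => hs.deriv
  have h2 : deriv (deriv g) a = c := he.deriv_eq.trans hd'.deriv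
  have hmax := isLocalMax_of_deriv_deriv_neg (h2 ▸ hc) hg.deriv_eq_zero
    hd.self_of_nhds.continuousAt
  have hconst : g =ᶠ[𝓝 a] fun _ => g a := by
    filter_upwards [hg, hmax] with s h1 h2 using le_antisymm h2 h1
  have h3 : deriv g =ᶠ[𝓝 a] fun _ => 0 := by
    filter_upwards [hconst.eventuallyEq_nhds] with s hs
    rw [hs.deriv_eq, deriv_const]
  rw [h3.deriv_eq, deriv_const] at h2
  linarith

open Filter Topology in
theorem barrier_hessian_nonneg {n : ℕ} {w : EuclideanSpace ℝ (Fin n) → ℝ}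
    {x : EuclideanSpace ℝ (Fin n)} {c : ℝ} (hw : ContDiffAt ℝ 2 w x)
    (hmin : IsLocalMin (fun y => ‖y‖ ^ 2 + (w y - c) ^ 2) x) (h : EuclideanSpace ℝ (Fin n)) :
    0 ≤ ‖h‖ ^ 2 + inner ℝ (gradient w x) h ^ 2 +
      (w x - c) * inner ℝ (fderiv ℝ (gradient w) x h) h := by
  have hline : ∀ s : ℝ, HasDerivAt (fun s : ℝ => x + s • h) h s := fun s => by
    simpa using ((hasDerivAt_id s).smul_const h).const_add x
  have hcont : Tendsto (fun s : ℝ => x + s • h) (𝓝 0) (𝓝 x) := by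
    simpa using (hline 0).continuousAt.tendsto
  have hwd : ∀ᶠ s : ℝ in 𝓝 0, HasDerivAt (fun s : ℝ => w (x + s • h))
      (inner ℝ (gradient w (x + s • h)) h) s := by
    filter_upwards [hcont.eventually (hw.eventually (by norm_num))] with s hs
    have := (hs.differentiableAt (by norm_num)).hasFDerivAt.comp_hasDerivAt s (hline s)
    rwa [← inner_gradient_left] at this
  have hP : HasDerivAt (fun s : ℝ => gradient w (x + s • h)) (fderiv ℝ (gradient w) x h) 0 := by
    have h0 : HasFDerivAt (gradient w) (fderiv ℝ (gradient w) x) (x + (0 : ℝ) • h) := by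
      simpa using (differentiableAt_gradient hw).hasFDerivAt
    exact h0.comp_hasDerivAt (0 : ℝ) (hline 0)
  have hmin' : IsLocalMin (fun s : ℝ => ‖x + s • h‖ ^ 2 + (w (x + s • h) - c) ^ 2) 0 := by
    have := hcont.eventually hmin
    simpa [IsLocalMin, IsMinFilter] using this
  have hnn := hmin'.second_deriv_nonneg
    (g' := fun s => 2 * inner ℝ (x + s • h) h +
      2 * ((w (x + s • h) - c) * inner ℝ (gradient w (x + s • h)) h))
    (c := 2 * ‖h‖ ^ 2 + 2 * (inner ℝ (gradient w x) h * inner ℝ (gradient w x) h +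
      (w x - c) * inner ℝ (fderiv ℝ (gradient w) x h) h)) ?_ ?_
  · linarith
  · filter_upwards [hwd] with s hs
    refine ((hline s).norm_sq.add ((hs.sub_const c).pow 2)).congr_deriv ?_
    simp; ring
  · have h1 := ((hline 0).inner ℝ (hasDerivAt_const 0 h)).const_mul 2
    have h2 := (((hwd.self_of_nhds.sub_const c).mul
      (hP.inner ℝ (hasDerivAt_const 0 h)))).const_mul 2
    refine (h1.add h2).congr_deriv ?_
    simp

/-- Half the Hessian of the barrier function is `A = I + P ⊗ P + (w - c) D²w` with `P = dw`,
nonnegative at a minimum. Its trace against the inverse metric is the asserted quantity, because `I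
+ P ⊗ P` is the metric and has trace `n`. This trace is nonnegative since `⟨AP, P⟩ ≤ |P|² tr A` and
`|P|² < v²`. -/
theorem barrier_operator_nonneg {n : ℕ} {w : EuclideanSpace ℝ (Fin n) → ℝ}
    {x : EuclideanSpace ℝ (Fin n)} {c : ℝ} (hw : ContDiffAt ℝ 2 w x)
    (hmin : IsLocalMin (fun y => ‖y‖ ^ 2 + (w y - c) ^ 2) x) :
    0 ≤ n + (w x - c) * (volumeElement w x * divergence (conormal w) x) := by
  set P := gradient w x
  set A : EuclideanSpace ℝ (Fin n) →L[ℝ] EuclideanSpace ℝ (Fin n) :=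
    ContinuousLinearMap.id ℝ _ + (innerSL ℝ P).smulRight P + (w x - c) • fderiv ℝ (gradient w) x
    with hAdef
  have hA : ∀ h, inner ℝ (A h) h = ‖h‖ ^ 2 + inner ℝ P h ^ 2 +
      (w x - c) * inner ℝ (fderiv ℝ (gradient w) x h) h := by
    intro h
    simp [hAdef, inner_add_left, real_inner_smul_left]
    ring
  have hnn := inner_apply_le_norm_sq_mul_sum A
    (fun h => (hA h).symm ▸ barrier_hessian_nonneg hw hmin h) P
  have htr : ∑ i, (A (EuclideanSpace.single i 1)) i =
      n + ‖P‖ ^ 2 + (w x - c) * divergence (gradient w) x := by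
    have : ∀ i, (A (EuclideanSpace.single i 1)) i = 1 + P i ^ 2 + (w x - c) *
        (fderiv ℝ (gradient w) x (EuclideanSpace.single i 1)) i := by
      intro i
      simp [hAdef, EuclideanSpace.inner_single_right]
      ring
    simp only [this, Finset.sum_add_distrib, ← Finset.mul_sum, EuclideanSpace.real_norm_sq_eq,
      divergence]
    simp
  rw [hA, htr, real_inner_self_eq_norm_sq] at hnn
  rw [volumeElement_mul_divergence_conormal hw]
  have hv := volumeElement_sq w x
  have hv0 := volumeElement_pos w x
  change _ = 1 + ‖P‖ ^ 2 at hv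
  set d := divergence (gradient w) x
  set a := inner ℝ (fderiv ℝ (gradient w) x P) P
  have hT : 0 ≤ n + ‖P‖ ^ 2 + (w x - c) * d := by
    rw [← htr]
    exact Finset.sum_nonneg fun i _ => by
      have := (hA (EuclideanSpace.single i 1)).symm ▸
        barrier_hessian_nonneg hw hmin (EuclideanSpace.single i 1)
      simpa [EuclideanSpace.inner_single_right] using this
  have key : 0 ≤ volumeElement w x ^ 2 * (n + (w x - c) * (d - a / volumeElement w x ^ 2)) := by
    have : volumeElement w x ^ 2 * (n + (w x - c) * (d - a / volumeElement w x ^ 2)) =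
        volumeElement w x ^ 2 * (n + (w x - c) * d) - (w x - c) * a := by
      field_simp
      ring
    rw [this, hv]
    nlinarith
  exact nonneg_of_mul_nonneg_right key (by positivity)

namespace GraphFlowsByMeanCurvature

variable {n : ℕ} {u : EuclideanSpace ℝ (Fin n) → ℝ → ℝ} {ρ T : ℝ}

open Topology in
theorem contDiffAt (hu : GraphFlowsByMeanCurvature u ρ T) {x : EuclideanSpace ℝ (Fin n)} {t : ℝ}
    (hx : x ∈ Metric.ball 0 ρ) (ht : t ∈ Set.Ioo 0 T) :
    ContDiffAt ℝ ∞ (fun p : EuclideanSpace ℝ (Fin n) × ℝ => u p.1 p.2) (x, t) :=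
  hu.smooth.contDiffAt (prod_mem_nhds (Metric.isOpen_ball.mem_nhds hx)
    (Icc_mem_nhds ht.1 ht.2))

theorem contDiffAt_slice (hu : GraphFlowsByMeanCurvature u ρ T) {x : EuclideanSpace ℝ (Fin n)}
    {t : ℝ} (hx : x ∈ Metric.ball 0 ρ) (ht : t ∈ Set.Ioo 0 T) :
    ContDiffAt ℝ ∞ (fun y => u y t) x :=
  (hu.contDiffAt hx ht).comp (f := fun y => (y, t)) x (by fun_prop)

theorem hasDerivAt (hu : GraphFlowsByMeanCurvature u ρ T) {x : EuclideanSpace ℝ (Fin n)}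
    {t : ℝ} (hx : x ∈ Metric.ball 0 ρ) (ht : t ∈ Set.Ioo 0 T) :
    HasDerivAt (fun s => u x s) (volumeElement (fun y => u y t) x *
      divergence (conormal fun y => u y t) x) t := by
  have h1 : ContDiffAt ℝ ∞ (fun s => u x s) t :=
    (hu.contDiffAt hx ht).comp (f := fun s => (x, s)) t (by fun_prop)
  have h2 := hu.flow x hx t ⟨ht.1.le, ht.2.le⟩
  rw [derivWithin_of_mem_nhds (Icc_mem_nhds ht.1 ht.2)] at h2
  exact h2 ▸ (h1.differentiableAt (by simp)).hasDerivAt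

/-- Avoidance principle: a graph initially outside the sphere of radius `R` about `(0, c)` stays
outside the sphere of squared radius `R² - 2nt`. The lateral boundary `|x| = R` needs no condition.
-/
theorem sphere_barrier (hu : GraphFlowsByMeanCurvature u ρ T) {R c : ℝ} (hR : 0 < R)
    (hRρ : R < ρ) (h0 : ∀ x ∈ Metric.closedBall (0 : EuclideanSpace ℝ (Fin n)) R, R ≤ |u x 0 - c|)
    {x : EuclideanSpace ℝ (Fin n)} (hx : x ∈ Metric.closedBall 0 R) {t : ℝ}
    (ht : t ∈ Set.Ico 0 T) : R ^ 2 ≤ ‖x‖ ^ 2 + (u x t - c) ^ 2 + 2 * n * t := by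
  have hsub : Metric.closedBall (0 : EuclideanSpace ℝ (Fin n)) R ⊆ Metric.ball 0 ρ :=
    Metric.closedBall_subset_ball hRρ
  -- The extra `ε t` makes the inequality strict at an interior minimum; it is removed at the end by
  -- letting `ε` tend to zero.
  have key : ∀ ε > 0, R ^ 2 ≤ ‖x‖ ^ 2 + (u x t - c) ^ 2 + 2 * n * t + ε * t := by
    intro ε hε
    set F : EuclideanSpace ℝ (Fin n) × ℝ → ℝ :=
      fun p => ‖p.1‖ ^ 2 + (u p.1 p.2 - c) ^ 2 + 2 * n * p.2 + ε * p.2 with hF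
    have hcont : ContinuousOn F (Metric.closedBall 0 R ×ˢ Set.Icc 0 t) := by
      have := hu.smooth.continuousOn.mono
        (Set.prod_mono hsub (Set.Icc_subset_Icc_right ht.2.le))
      fun_prop
    obtain ⟨⟨x0, t0⟩, ⟨hx0, ht0⟩, hmin⟩ :=
      ((isCompact_closedBall (0 : EuclideanSpace ℝ (Fin n)) R).prod
        isCompact_Icc).exists_isMinOn ⟨(x, t), hx, ht.1, le_rfl⟩ hcont
    replace hmin : ∀ y ∈ Metric.closedBall (0 : EuclideanSpace ℝ (Fin n)) R, ∀ s ∈ Set.Icc 0 t,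
        F (x0, t0) ≤ F (y, s) := fun y hy s hs => isMinOn_iff.1 hmin (y, s) ⟨hy, hs⟩
    simp only at hx0 ht0
    refine le_trans ?_ (hmin x hx t ⟨ht.1, le_rfl⟩)
    have hn : (0 : ℝ) ≤ n := n.cast_nonneg
    have hx0' : ‖x0‖ ≤ R := by simpa using hx0
    rcases ht0.1.eq_or_lt with h | hpos
    · subst h
      have := h0 x0 hx0
      simp only [hF, mul_zero, add_zero]
      have := pow_le_pow_left₀ hR.le this 2
      rw [sq_abs] at this
      nlinarith [sq_nonneg ‖x0‖]
    rcases hx0'.eq_or_lt with h | hlt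
    · simp only [hF, h]
      have : 0 ≤ 2 * n * t0 := by positivity
      have : 0 ≤ ε * t0 := by positivity
      nlinarith [sq_nonneg (u x0 t0 - c)]
    exfalso
    have hI : t0 ∈ Set.Ioo 0 T := ⟨hpos, ht0.2.trans_lt ht.2⟩
    have hxb : x0 ∈ Metric.ball 0 ρ := hsub hx0
    have hspace : IsLocalMin (fun y => ‖y‖ ^ 2 + (u y t0 - c) ^ 2) x0 := by
      filter_upwards [Metric.isOpen_ball.mem_nhds
        (show x0 ∈ Metric.ball 0 R by simpa using hlt)] with y hy
      have := hmin y (Metric.ball_subset_closedBall hy) t0 ht0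
      simp only [hF] at this
      linarith
    have h1 := barrier_operator_nonneg
      ((hu.contDiffAt_slice hxb hI).of_le (WithTop.coe_le_coe.2 le_top)) hspace
    set D := volumeElement (fun y => u y t0) x0 * divergence (conormal fun y => u y t0) x0
    have hder : HasDerivAt (fun s => F (x0, s)) (2 * ((u x0 t0 - c) * D) + 2 * n + ε) t0 := by
      have := (((((hu.hasDerivAt hxb hI).sub_const c).pow 2).const_add (‖x0‖ ^ 2)).add
        ((hasDerivAt_id t0).const_mul (2 * n : ℝ))).add ((hasDerivAt_id t0).const_mul ε)
      refine this.congr_deriv ?_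
      simp only [D]
      norm_num
      ring
    have htime : IsLocalMinOn (fun s => F (x0, s)) (Set.Icc 0 t) t0 :=
      (isMinOn_iff.2 fun s hs => hmin x0 hx0 s hs).localize
    -- The minimum may occur at the last time `t`, so only the backward direction `0 - t0` is
    -- tested.
    have h2 := htime.hasFDerivWithinAt_nonneg hder.hasFDerivAt.hasFDerivWithinAt
      (y := 0 - t0) (sub_mem_posTangentConeAt_of_segment_subset
        ((convex_Icc 0 t).segment_subset ht0 ⟨le_rfl, ht.1⟩))
    simp at h2
    nlinarith
  refine le_of_forall_pos_le_add fun δ hδ => ?_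
  have h := key (δ / (t + 1)) (div_pos hδ (by linarith [ht.1]))
  have : δ / (t + 1) * t ≤ δ := by
    rw [div_mul_eq_mul_div, div_le_iff₀ (by linarith [ht.1])]
    nlinarith [ht.1]
  linarith

/-- Spheres centered at height `c` with `|c| ≥ M + R` start disjoint from the graph. To exceed `M +
R` in absolute value, `u x` would have to equal `M + R` or `-(M + R)` at some time, placing the
graph inside such a sphere. -/
theorem abs_apply_le (hu : GraphFlowsByMeanCurvature u ρ T) {R M : ℝ} (hR : 0 < R) (hRρ : R < ρ)
    (h0 : ∀ x ∈ Metric.ball (0 : EuclideanSpace ℝ (Fin n)) ρ, |u x 0| ≤ M)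
    {x : EuclideanSpace ℝ (Fin n)} {t : ℝ} (ht : t ∈ Set.Ico 0 T)
    (hxt : ‖x‖ ^ 2 + 2 * n * t < R ^ 2) : |u x t| ≤ M + R := by
  have hn : (0 : ℝ) ≤ n := n.cast_nonneg
  have hxR : x ∈ Metric.closedBall (0 : EuclideanSpace ℝ (Fin n)) R := by
    have : ‖x‖ ^ 2 < R ^ 2 := by nlinarith [mul_nonneg hn ht.1]
    simpa using (lt_of_pow_lt_pow_left₀ 2 hR.le this).le
  have hxρ := Metric.closedBall_subset_ball hRρ hxR
  have h0' : ∀ y ∈ Metric.closedBall (0 : EuclideanSpace ℝ (Fin n)) R, |u y 0| ≤ M :=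
    fun y hy => h0 y (Metric.closedBall_subset_ball hRρ hy)
  have hcont : ContinuousOn (fun s => u x s) (Set.Icc 0 t) :=
    hu.smooth.continuousOn.comp (f := fun s => (x, s)) (by fun_prop)
      fun s hs => ⟨hxρ, hs.1, hs.2.trans ht.2.le⟩
  have hne : ∀ c : ℝ, M + R ≤ |c| → ∀ s ∈ Set.Icc 0 t, u x s ≠ c := by
    intro c hc s hs h
    have := hu.sphere_barrier (c := c) hR hRρ (fun y hy => by
      have h1 := h0' y hy
      have h2 := abs_sub_abs_le_abs_sub c (u y 0)
      rw [abs_sub_comm] at h2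
      linarith) hxR ⟨hs.1, hs.2.trans_lt ht.2⟩
    rw [h] at this
    nlinarith [mul_le_mul_of_nonneg_left hs.2 hn]
  have h00 := h0 x hxρ
  have hM : 0 ≤ M := (abs_nonneg _).trans h00
  have hst := abs_le.1 h00
  by_contra! hlt
  rcases lt_abs.1 hlt with h | h
  · obtain ⟨s, hs, he⟩ := intermediate_value_Icc ht.1 hcont
      (show M + R ∈ Set.Icc (u x 0) (u x t) from ⟨by linarith, h.le⟩)
    exact hne (M + R) (le_abs_self _) s hs he
  · obtain ⟨s, hs, he⟩ := intermediate_value_Icc' ht.1 hcont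
      (show -(M + R) ∈ Set.Icc (u x t) (u x 0) from ⟨by linarith, by linarith⟩)
    exact hne (-(M + R)) (by rw [abs_neg]; exact le_abs_self _) s hs he

end GraphFlowsByMeanCurvature

/-! ### Cutoff powers and differentiation under the integral -/

theorem hasDerivAt_max_zero_pow (k : ℕ) (s : ℝ) :
    HasDerivAt (fun s : ℝ => max s 0 ^ (k + 2)) ((k + 2) * max s 0 ^ (k + 1)) s := by
  rcases lt_trichotomy s 0 with h | rfl | h
  · have he : (fun s : ℝ => max s 0 ^ (k + 2)) =ᶠ[nhds s] fun _ => 0 := by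
      filter_upwards [Iio_mem_nhds h] with r (hr : r < 0)
      simp [max_eq_right hr.le]
    simpa [max_eq_right h.le] using (hasDerivAt_const s (0 : ℝ)).congr_of_eventuallyEq he
  · have : HasFDerivAt (fun s : ℝ => max s 0 ^ (k + 2)) (0 : ℝ →L[ℝ] ℝ) 0 := by
      refine Asymptotics.IsBigO.hasFDerivAt (n := k + 2) ?_ (by omega)
      refine Asymptotics.IsBigO.of_bound 1 (Filter.Eventually.of_forall fun r => ?_)
      simp only [sub_zero, norm_pow, norm_norm, one_mul]
      refine pow_le_pow_left₀ (norm_nonneg _) ?_ _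
      rw [Real.norm_eq_abs, Real.norm_eq_abs, abs_of_nonneg (le_max_right _ _)]
      exact max_le (le_abs_self r) (abs_nonneg r)
    simpa using this.hasDerivAt
  · have he : (fun s : ℝ => max s 0 ^ (k + 2)) =ᶠ[nhds s] fun r => r ^ (k + 2) := by
      filter_upwards [Ioi_mem_nhds h] with r (hr : 0 < r)
      simp [max_eq_left hr.le]
    have := (hasDerivAt_pow (k + 2) s).congr_of_eventuallyEq he
    simpa [max_eq_left h.le] using this

/-- The cube is used as weight so that the square, which its gradient produces, is still `C¹` and
the divergence theorem applies to it. -/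
theorem contDiff_max_zero_pow (k : ℕ) : ContDiff ℝ 1 (fun s : ℝ => max s 0 ^ (k + 2)) := by
  rw [contDiff_one_iff_deriv]
  refine ⟨fun s => (hasDerivAt_max_zero_pow k s).differentiableAt, ?_⟩
  rw [show deriv (fun s : ℝ => max s 0 ^ (k + 2)) =
      fun s => ((k : ℝ) + 2) * max s 0 ^ (k + 1) from
    funext fun s => (hasDerivAt_max_zero_pow k s).deriv]
  fun_prop

open MeasureTheory in
theorem hasDerivAt_integral_of_contDiff {n : ℕ} {g : EuclideanSpace ℝ (Fin n) × ℝ → ℝ}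
    (hg : ContDiff ℝ 1 g) {K : Set (EuclideanSpace ℝ (Fin n))} (hK : IsCompact K) {s : Set ℝ}
    (hs : IsOpen s) (hgK : ∀ t ∈ s, ∀ x ∉ K, g (x, t) = 0) {t : ℝ} (ht : t ∈ s) :
    Integrable (fun x => fderiv ℝ g (x, t) (0, 1)) ∧
      HasDerivAt (fun t => ∫ x, g (x, t)) (∫ x, fderiv ℝ g (x, t) (0, 1)) t := by
  obtain ⟨ε, hε, hεs⟩ := Metric.nhds_basis_closedBall.mem_iff.1 (hs.mem_nhds ht)
  have hd : ∀ x r, HasDerivAt (fun r => g (x, r)) (fderiv ℝ g (x, r) (0, 1)) r := fun x r =>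
    ((hg.differentiable (by norm_num) (x, r)).hasFDerivAt.comp_hasDerivAt r
      ((hasDerivAt_const r x).prodMk (hasDerivAt_id r)))
  have hc : Continuous (fun z => fderiv ℝ g z (0, 1)) :=
    (hg.continuous_fderiv (by norm_num)).clm_apply continuous_const
  obtain ⟨C, hC⟩ := (hK.prod (isCompact_closedBall t ε)).exists_bound_of_continuousOn
    hc.continuousOn
  have hz : ∀ r ∈ s, ∀ x ∉ K, fderiv ℝ g (x, r) (0, 1) = 0 := by
    intro r hr x hx
    rw [← (hd x r).deriv]
    have : (fun r => g (x, r)) =ᶠ[nhds r] fun _ => 0 := by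
      filter_upwards [hs.mem_nhds hr] with r' hr' using hgK r' hr' x hx
    rw [this.deriv_eq, deriv_const]
  refine hasDerivAt_integral_of_dominated_loc_of_deriv_le (F := fun t x => g (x, t))
    (F' := fun t x => fderiv ℝ g (x, t) (0, 1)) (bound := K.indicator fun _ => C)
    (Metric.ball_mem_nhds t hε) ?_ ?_ ?_ ?_ ?_ ?_
  · exact Filter.Eventually.of_forall fun r =>
      (hg.continuous.comp (by fun_prop : Continuous fun x => (x, r))).aestronglyMeasurable
  · exact (hg.continuous.comp (by fun_prop :
      Continuous fun x => (x, t))).integrable_of_hasCompactSupport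
        (HasCompactSupport.intro hK fun x hx => hgK t ht x hx)
  · exact (hc.comp (by fun_prop : Continuous fun x => (x, t))).aestronglyMeasurable
  · refine Filter.Eventually.of_forall fun x r hr => ?_
    by_cases hx : x ∈ K
    · rw [Set.indicator_of_mem hx]
      exact hC (x, r) ⟨hx, Metric.ball_subset_closedBall hr⟩
    · rw [Set.indicator_of_notMem hx, hz r (hεs (Metric.ball_subset_closedBall hr)) x hx, norm_zero]
  · exact (integrable_indicator_iff hK.measurableSet).2
      (integrableOn_const hK.measure_lt_top.ne)
  · exact Filter.Eventually.of_forall fun x r _ => hd x r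

/-! ### Slices of a smooth space-time function -/

section SpaceTime

variable {n : ℕ} {U : EuclideanSpace ℝ (Fin n) × ℝ → ℝ}

theorem contDiff_spaceTime_gradient (hU : ContDiff ℝ ∞ U) :
    ContDiff ℝ ∞ (fun z : EuclideanSpace ℝ (Fin n) × ℝ => gradient (fun y => U (y, z.2)) z.1) := by
  have h : ∀ z : EuclideanSpace ℝ (Fin n) × ℝ, gradient (fun y => U (y, z.2)) z.1 =
      (InnerProductSpace.toDual ℝ (EuclideanSpace ℝ (Fin n))).symm
        ((fderiv ℝ U z).comp (ContinuousLinearMap.inl ℝ _ ℝ)) := by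
    intro z
    have h1 : HasFDerivAt (fun y : EuclideanSpace ℝ (Fin n) => (y, z.2))
        (ContinuousLinearMap.inl ℝ _ ℝ) z.1 := hasFDerivAt_prodMk_left z.1 z.2
    have h2 : HasFDerivAt (fun y => U (y, z.2)) _ z.1 :=
      ((hU.differentiable (by simp) (z.1, z.2)).hasFDerivAt.comp z.1 h1)
    rw [gradient, h2.fderiv]
  simp only [h]
  exact (InnerProductSpace.toDual ℝ (EuclideanSpace ℝ (Fin n))).symm.contDiff.comp
    ((hU.fderiv_right (m := ∞) (by simp)).clm_comp contDiff_const)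

theorem contDiff_slice (hU : ContDiff ℝ ∞ U) (t : ℝ) : ContDiff ℝ ∞ (fun y => U (y, t)) :=
  hU.comp (by fun_prop)

theorem contDiff_spaceTime_volumeElement (hU : ContDiff ℝ ∞ U) :
    ContDiff ℝ ∞ (fun z : EuclideanSpace ℝ (Fin n) × ℝ =>
      volumeElement (fun y => U (y, z.2)) z.1) := by
  unfold volumeElement
  exact (contDiff_const.add ((contDiff_spaceTime_gradient hU).norm_sq ℝ)).sqrt
    fun z => by positivity

theorem contDiff_conormal (hU : ContDiff ℝ ∞ U) (t : ℝ) :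
    ContDiff ℝ ∞ (conormal fun y => U (y, t)) := by
  have h : ContDiff ℝ ∞ (fun x : EuclideanSpace ℝ (Fin n) => (x, t)) := by fun_prop
  exact (((contDiff_spaceTime_volumeElement hU).comp h).inv
    fun x => (volumeElement_pos _ _).ne').smul ((contDiff_spaceTime_gradient hU).comp h)

theorem contDiff_timeDeriv (hU : ContDiff ℝ ∞ U) :
    ContDiff ℝ ∞ (fun z => fderiv ℝ U z (0, 1)) :=
  (hU.fderiv_right (m := ∞) (by simp)).clm_apply contDiff_const

theorem inner_gradient_slice (hU : ContDiff ℝ ∞ U) (x k : EuclideanSpace ℝ (Fin n)) (t : ℝ) :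
    inner ℝ (gradient (fun y => U (y, t)) x) k = fderiv ℝ U (x, t) (k, 0) := by
  have h2 : HasFDerivAt (fun y => U (y, t)) _ x :=
    ((hU.differentiable (by simp) (x, t)).hasFDerivAt.comp x (hasFDerivAt_prodMk_left x t))
  rw [inner_gradient_left, h2.fderiv]
  simp

/-- Time derivative and spatial gradient commute, by symmetry of the second derivative of `U` on
space-time. -/
theorem exists_hasDerivAt_gradient (hU : ContDiff ℝ ∞ U) (x : EuclideanSpace ℝ (Fin n)) (t : ℝ) :
    ∃ P' : EuclideanSpace ℝ (Fin n),
      HasDerivAt (fun s => gradient (fun y => U (y, s)) x) P' t ∧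
      HasFDerivAt (fun y => fderiv ℝ U (y, t) (0, 1)) (innerSL ℝ P') x := by
  have hG := contDiff_spaceTime_gradient hU
  have h1 := ((hG.differentiable (by simp) (x, t)).hasFDerivAt.comp_hasDerivAt t
      ((hasDerivAt_const t x).prodMk (hasDerivAt_id t)))
  refine ⟨_, h1, ?_⟩
  have hD : DifferentiableAt ℝ (fderiv ℝ U) (x, t) :=
    (hU.fderiv_right (m := 1) (by norm_cast)).differentiable (by norm_num) _
  have h0 : HasFDerivAt (fun y => fderiv ℝ U (y, t)) _ x :=
    hD.hasFDerivAt.comp x (hasFDerivAt_prodMk_left x t)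
  have h2 := h0.clm_apply
    (hasFDerivAt_const ((0, 1) : EuclideanSpace ℝ (Fin n) × ℝ) x)
  refine h2.congr_fderiv ?_
  ext k
  have h3 := h1.inner ℝ (hasDerivAt_const t k)
  have h6 : HasDerivAt (fun s => fderiv ℝ U (x, s)) _ t :=
    hD.hasFDerivAt.comp_hasDerivAt t ((hasDerivAt_const t x).prodMk (hasDerivAt_id t))
  have h4 := h6.clm_apply
    (hasDerivAt_const t ((k, 0) : EuclideanSpace ℝ (Fin n) × ℝ))
  have h5 := h3.unique (h4.congr_of_eventuallyEq (Filter.Eventually.of_forall fun s =>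
    inner_gradient_slice hU x k s))
  have hsymm := (hU.contDiffAt (x := (x, t))).isSymmSndFDerivAt
    (by simpa using (WithTop.coe_le_coe.2 le_top : (2 : ℕ∞ω) ≤ ∞)) (0, 1) (k, 0)
  simp at h5 ⊢
  rw [h5, hsymm]

end SpaceTime

/-! ### The parabolic cutoff -/

/-- The positive part of `ρ² - |x|² - 2nt`. -/
noncomputable def heatCutoff {n : ℕ} (ρ : ℝ) (z : EuclideanSpace ℝ (Fin n) × ℝ) : ℝ :=
  max (ρ ^ 2 - ‖z.1‖ ^ 2 - 2 * n * z.2) 0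

section HeatCutoff

variable {n : ℕ} {ρ : ℝ}

theorem heatCutoff_nonneg (z : EuclideanSpace ℝ (Fin n) × ℝ) : 0 ≤ heatCutoff ρ z :=
  le_max_right _ _

theorem heatCutoff_le {z : EuclideanSpace ℝ (Fin n) × ℝ} (hz : 0 ≤ z.2) :
    heatCutoff ρ z ≤ ρ ^ 2 := by
  refine max_le ?_ (sq_nonneg ρ)
  have : 0 ≤ 2 * n * z.2 := by positivity
  nlinarith [sq_nonneg ‖z.1‖]

theorem heatCutoff_pos_iff (z : EuclideanSpace ℝ (Fin n) × ℝ) :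
    0 < heatCutoff ρ z ↔ ‖z.1‖ ^ 2 + 2 * n * z.2 < ρ ^ 2 := by
  simp only [heatCutoff, lt_max_iff, lt_irrefl, or_false]
  constructor <;> intro h <;> linarith

theorem norm_le_of_heatCutoff_pos (hρ : 0 < ρ) {z : EuclideanSpace ℝ (Fin n) × ℝ} (hz : 0 ≤ z.2)
    (h : 0 < heatCutoff ρ z) : ‖z.1‖ ≤ ρ := by
  rw [heatCutoff_pos_iff] at h
  have : 0 ≤ 2 * n * z.2 := by positivity
  exact (lt_of_pow_lt_pow_left₀ 2 hρ.le (by linarith)).le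

theorem heatCutoff_eq_zero (hρ : 0 < ρ) {z : EuclideanSpace ℝ (Fin n) × ℝ} (hz : 0 ≤ z.2)
    (h : z.1 ∉ Metric.closedBall 0 ρ) : heatCutoff ρ z = 0 := by
  by_contra hne
  exact h (by simpa using
    norm_le_of_heatCutoff_pos hρ hz ((heatCutoff_nonneg z).lt_of_ne' hne))

theorem continuous_heatCutoff : Continuous (heatCutoff (n := n) ρ) := by
  unfold heatCutoff; fun_prop

theorem contDiff_heatCutoff_pow (k : ℕ) :
    ContDiff ℝ 1 (fun z : EuclideanSpace ℝ (Fin n) × ℝ => heatCutoff ρ z ^ (k + 2)) := by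
  refine (contDiff_max_zero_pow k).comp
    (g := fun s : ℝ => max s 0 ^ (k + 2))
    (f := fun z : EuclideanSpace ℝ (Fin n) × ℝ => ρ ^ 2 - ‖z.1‖ ^ 2 - 2 * n * z.2) ?_
  have := (contDiff_fst (𝕜 := ℝ) (n := 1) (E := EuclideanSpace ℝ (Fin n)) (F := ℝ)).norm_sq ℝ
  fun_prop

theorem hasFDerivAt_heatCutoff_pow (k : ℕ) (x : EuclideanSpace ℝ (Fin n)) (t : ℝ) :
    HasFDerivAt (fun y => heatCutoff ρ (y, t) ^ (k + 2))
      ((-2 * (k + 2) * heatCutoff ρ (x, t) ^ (k + 1)) • innerSL ℝ x) x := by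
  have h1 : HasFDerivAt (fun y : EuclideanSpace ℝ (Fin n) => ρ ^ 2 - ‖y‖ ^ 2 - 2 * n * t) _ x :=
    (((hasFDerivAt_id x).norm_sq.const_sub (ρ ^ 2)).sub_const (2 * n * t))
  refine ((hasDerivAt_max_zero_pow k _).comp_hasFDerivAt x h1).congr_fderiv ?_
  ext h
  simp [heatCutoff]
  ring

theorem hasDerivAt_heatCutoff_pow (k : ℕ) (x : EuclideanSpace ℝ (Fin n)) (t : ℝ) :
    HasDerivAt (fun s => heatCutoff ρ (x, s) ^ (k + 2))
      (-(2 * n) * (k + 2) * heatCutoff ρ (x, t) ^ (k + 1)) t := by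
  have h1 : HasDerivAt (fun s : ℝ => ρ ^ 2 - ‖x‖ ^ 2 - 2 * n * s) _ t :=
    ((hasDerivAt_id t).const_mul (2 * n : ℝ)).const_sub (ρ ^ 2 - ‖x‖ ^ 2)
  refine ((hasDerivAt_max_zero_pow k _).comp t h1).congr_deriv ?_
  simp [heatCutoff]
  ring

end HeatCutoff

/-! ### Evolution of the localized area, and its control by curvature -/

theorem norm_conormal_le_one {n : ℕ} (w : EuclideanSpace ℝ (Fin n) → ℝ)
    (x : EuclideanSpace ℝ (Fin n)) : ‖conormal w x‖ ≤ 1 := by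
  have h1 := volumeElement_pos w x
  rw [conormal, norm_smul, norm_inv, Real.norm_of_nonneg h1.le, inv_mul_le_iff₀ h1, mul_one]
  exact le_of_sq_le_sq (by rw [volumeElement_sq]; linarith) h1.le

theorem gradient_eq_smul_conormal {n : ℕ} (w : EuclideanSpace ℝ (Fin n) → ℝ)
    (x : EuclideanSpace ℝ (Fin n)) : gradient w x = volumeElement w x • conormal w x := by
  rw [conormal, smul_inv_smul₀ (volumeElement_pos w x).ne']

/-- The product is `v (|x|² - ⟨N, x⟩²)`, so this is Cauchy–Schwarz with `|N| ≤ 1`. -/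
theorem inner_positionField_nonneg {n : ℕ} (w : EuclideanSpace ℝ (Fin n) → ℝ)
    (x : EuclideanSpace ℝ (Fin n)) : 0 ≤ inner ℝ x (positionField w x) := by
  have h1 := volumeElement_pos w x
  rw [positionField, gradient_eq_smul_conormal, inner_sub_right, real_inner_smul_right,
    real_inner_smul_right, real_inner_smul_left, real_inner_self_eq_norm_sq,
    real_inner_comm x]
  have h2 : |inner ℝ x (conormal w x)| ≤ ‖x‖ := (abs_real_inner_le_norm _ _).trans
    (mul_le_of_le_one_right (norm_nonneg _) (norm_conormal_le_one w x))
  have h3 : inner ℝ x (conormal w x) ^ 2 ≤ ‖x‖ ^ 2 := by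
    rw [← sq_abs]; exact pow_le_pow_left₀ (abs_nonneg _) h2 2
  nlinarith

section Energy

variable {n : ℕ} {U : EuclideanSpace ℝ (Fin n) × ℝ → ℝ} {ρ : ℝ}

theorem contDiff_positionField (hU : ContDiff ℝ ∞ U) (t : ℝ) :
    ContDiff ℝ ∞ (positionField fun y => U (y, t)) := by
  have h : ContDiff ℝ ∞ (fun x : EuclideanSpace ℝ (Fin n) => (x, t)) := by fun_prop
  exact (((contDiff_spaceTime_volumeElement hU).comp h).smul contDiff_id).sub
    ((((contDiff_spaceTime_gradient hU).comp h).inner ℝ contDiff_id).smul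
      (contDiff_conormal hU t))

theorem hasDerivAt_volumeElement {x P' : EuclideanSpace ℝ (Fin n)} {t : ℝ}
    (hP : HasDerivAt (fun s => gradient (fun y => U (y, s)) x) P' t) :
    HasDerivAt (fun s => volumeElement (fun y => U (y, s)) x)
      (inner ℝ P' (conormal (fun y => U (y, t)) x)) t := by
  refine ((hP.norm_sq.const_add 1).sqrt (by positivity)).congr_deriv ?_
  rw [conormal, real_inner_smul_right, volumeElement, real_inner_comm]
  field_simp

/-- The localized area `∫ (ρ² - |x|² - 2nt)₊³ v dx` of the graph of `U(·, t)`. -/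
noncomputable def localizedArea (ρ : ℝ) (U : EuclideanSpace ℝ (Fin n) × ℝ → ℝ) (t : ℝ) : ℝ :=
  ∫ x, heatCutoff ρ (x, t) ^ 3 * volumeElement (fun y => U (y, t)) x

/-- The localized integral `∫ (ρ² - |x|² - 2nt)₊³ u_t² / v dx` of the squared mean curvature. -/
noncomputable def localizedCurvature (ρ : ℝ) (U : EuclideanSpace ℝ (Fin n) × ℝ → ℝ) (t : ℝ) :
    ℝ :=
  ∫ x, heatCutoff ρ (x, t) ^ 3 *
    (fderiv ℝ U (x, t) (0, 1) ^ 2 / volumeElement (fun y => U (y, t)) x)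

/-- The pointwise form of `A' ≤ -B`. Moving the derivative off `u_t` produces `6 φ² v ⟨x, N⟩ div N`;
the divergence of `6 φ² (v x - ⟨du, x⟩ N)` absorbs it together with the `-6n φ² v` coming from the
time derivative of the weight. -/
theorem localized_first_variation (hU : ContDiff ℝ ∞ U) {x : EuclideanSpace ℝ (Fin n)} {t : ℝ}
    (hflow : 0 < heatCutoff ρ (x, t) → fderiv ℝ U (x, t) (0, 1) =
      volumeElement (fun y => U (y, t)) x * divergence (conormal fun y => U (y, t)) x) :
    fderiv ℝ (fun z : EuclideanSpace ℝ (Fin n) × ℝ =>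
        heatCutoff ρ z ^ 3 * volumeElement (fun y => U (y, z.2)) z.1) (x, t) (0, 1) ≤
      divergence (fun y => (fderiv ℝ U (y, t) (0, 1) * heatCutoff ρ (y, t) ^ 3) •
        conormal (fun y => U (y, t)) y) x -
      divergence (fun y => (6 * heatCutoff ρ (y, t) ^ 2) • positionField (fun y => U (y, t)) y) x -
      heatCutoff ρ (x, t) ^ 3 *
        (fderiv ℝ U (x, t) (0, 1) ^ 2 / volumeElement (fun y => U (y, t)) x) := by
  obtain ⟨P', hP, hut⟩ := exists_hasDerivAt_gradient hU x t
  have hv := volumeElement_pos (fun y => U (y, t)) x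
  have hw : ContDiffAt ℝ 2 (fun y => U (y, t)) x :=
    (contDiff_slice hU t).contDiffAt.of_le (WithTop.coe_le_coe.2 le_top)
  have htime : fderiv ℝ (fun z : EuclideanSpace ℝ (Fin n) × ℝ =>
        heatCutoff ρ z ^ 3 * volumeElement (fun y => U (y, z.2)) z.1) (x, t) (0, 1) =
      -(6 * n) * heatCutoff ρ (x, t) ^ 2 * volumeElement (fun y => U (y, t)) x +
        heatCutoff ρ (x, t) ^ 3 * inner ℝ P' (conormal (fun y => U (y, t)) x) := by
    have hd : ContDiff ℝ 1 (fun z : EuclideanSpace ℝ (Fin n) × ℝ =>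
        heatCutoff ρ z ^ 3 * volumeElement (fun y => U (y, z.2)) z.1) :=
      (contDiff_heatCutoff_pow 1).mul
        ((contDiff_spaceTime_volumeElement hU).of_le (by simp))
    have h1 := ((hd.differentiable (by norm_num) (x, t)).hasFDerivAt.comp_hasDerivAt t
      ((hasDerivAt_const t x).prodMk (hasDerivAt_id t)))
    have h2 := (hasDerivAt_heatCutoff_pow (ρ := ρ) 1 x t).mul (hasDerivAt_volumeElement hP)
    rw [h1.unique h2]
    push_cast
    ring
  have h3 : HasFDerivAt (fun y => heatCutoff ρ (y, t) ^ 3) _ x := hasFDerivAt_heatCutoff_pow 1 x t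
  have h2 : HasFDerivAt (fun y => 6 * heatCutoff ρ (y, t) ^ 2) _ x :=
    (hasFDerivAt_heatCutoff_pow 0 x t).const_mul 6
  rw [htime, divergence_smul (hut.fun_mul h3)
    (differentiableAt_conormal hw), divergence_smul h2 (differentiableAt_positionField hw),
    divergence_positionField hw]
  have hY := inner_positionField_nonneg (fun y => U (y, t)) x
  have hN : inner ℝ (gradient (fun y => U (y, t)) x) x = volumeElement (fun y => U (y, t)) x *
      inner ℝ (conormal (fun y => U (y, t)) x) x := by
    rw [gradient_eq_smul_conormal, real_inner_smul_left]
  simp only [add_apply, smul_apply, innerSL_apply_apply, smul_eq_mul,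
    hN, real_inner_comm (conormal (fun y => U (y, t)) x) x]
  rcases (heatCutoff_nonneg (ρ := ρ) (x, t)).eq_or_lt with h | h
  · simp [← h]
  rw [hflow h]
  set f := heatCutoff ρ (x, t)
  set v := volumeElement (fun y => U (y, t)) x
  set N := conormal (fun y => U (y, t)) x
  have e : (v * divergence (conormal fun y => U (y, t)) x) ^ 2 / v =
      v * divergence (conormal fun y => U (y, t)) x ^ 2 := by field_simp
  rw [e]
  -- These two terms, with coefficients 24 and 6, are all that the inequality discards.
  have p1 : 0 ≤ f * inner ℝ x (positionField (fun y => U (y, t)) x) := mul_nonneg h.le hY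
  have p2 : 0 ≤ f ^ 2 * v * ‖N‖ ^ 2 := by positivity
  push_cast
  ring_nf
  nlinarith

open MeasureTheory

theorem hasCompactSupport_smul_heatCutoff {E : Type*} [NormedAddCommGroup E] [NormedSpace ℝ E]
    (hρ : 0 < ρ) {t : ℝ} (ht : 0 ≤ t) {g : EuclideanSpace ℝ (Fin n) → ℝ}
    (hg : ∀ x, heatCutoff ρ (x, t) = 0 → g x = 0) (F : EuclideanSpace ℝ (Fin n) → E) :
    HasCompactSupport (fun x => g x • F x) :=
  HasCompactSupport.intro (isCompact_closedBall 0 ρ) fun x hx => by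
    rw [hg x (heatCutoff_eq_zero hρ ht hx), zero_smul]

theorem contDiff_heatCutoff_slice_pow (k : ℕ) (t : ℝ) :
    ContDiff ℝ 1 (fun x : EuclideanSpace ℝ (Fin n) => heatCutoff ρ (x, t) ^ (k + 2)) :=
  (contDiff_heatCutoff_pow k).comp (f := fun x => (x, t)) (by fun_prop)

theorem continuous_slice_volumeElement (hU : ContDiff ℝ ∞ U) (t : ℝ) :
    Continuous (fun x => volumeElement (fun y => U (y, t)) x) :=
  (contDiff_spaceTime_volumeElement hU).continuous.comp (f := fun x => (x, t)) (by fun_prop)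

theorem continuous_slice_timeDeriv (hU : ContDiff ℝ ∞ U) (t : ℝ) :
    Continuous (fun x => fderiv ℝ U (x, t) (0, 1)) :=
  (contDiff_timeDeriv hU).continuous.comp (f := fun x => (x, t)) (by fun_prop)

theorem continuous_slice_heatCutoff (t : ℝ) :
    Continuous (fun x : EuclideanSpace ℝ (Fin n) => heatCutoff ρ (x, t)) :=
  continuous_heatCutoff.comp (by fun_prop)

theorem integrable_localizedCurvature (hU : ContDiff ℝ ∞ U) (hρ : 0 < ρ) {t : ℝ} (ht : 0 ≤ t) :
    Integrable (fun x => heatCutoff ρ (x, t) ^ 3 *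
      (fderiv ℝ U (x, t) (0, 1) ^ 2 / volumeElement (fun y => U (y, t)) x)) :=
  Continuous.integrable_of_hasCompactSupport
    (((continuous_slice_heatCutoff t).pow 3).mul (((continuous_slice_timeDeriv hU t).pow 2).div
      (continuous_slice_volumeElement hU t) fun x => (volumeElement_pos _ _).ne'))
    (hasCompactSupport_smul_heatCutoff hρ ht (fun x hx => by simp [hx]) _)

theorem integrable_localizedArea (hU : ContDiff ℝ ∞ U) (hρ : 0 < ρ) {t : ℝ} (ht : 0 ≤ t) :
    Integrable (fun x => heatCutoff ρ (x, t) ^ 3 * volumeElement (fun y => U (y, t)) x) :=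
  Continuous.integrable_of_hasCompactSupport
    (((continuous_slice_heatCutoff t).pow 3).mul (continuous_slice_volumeElement hU t))
    (hasCompactSupport_smul_heatCutoff hρ ht (fun x hx => by simp [hx]) _)

theorem exists_hasDerivAt_localizedArea (hU : ContDiff ℝ ∞ U) (hρ : 0 < ρ) {t : ℝ} (ht : 0 < t)
    (hflow : ∀ x, 0 < heatCutoff ρ (x, t) → fderiv ℝ U (x, t) (0, 1) =
      volumeElement (fun y => U (y, t)) x * divergence (conormal fun y => U (y, t)) x) :
    ∃ A', HasDerivAt (localizedArea ρ U) A' t ∧ A' ≤ -localizedCurvature ρ U t := by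
  have hd : ContDiff ℝ 1 (fun z : EuclideanSpace ℝ (Fin n) × ℝ =>
      heatCutoff ρ z ^ 3 * volumeElement (fun y => U (y, z.2)) z.1) :=
    (contDiff_heatCutoff_pow 1).mul
      ((contDiff_spaceTime_volumeElement hU).of_le (by simp))
  obtain ⟨hint, hder⟩ := hasDerivAt_integral_of_contDiff hd
    (isCompact_closedBall (0 : EuclideanSpace ℝ (Fin n)) ρ) isOpen_Ioi
    (fun s (hs : 0 < s) x hx => by
      rw [heatCutoff_eq_zero (z := (x, s)) hρ hs.le hx]; simp) ht
  refine ⟨_, hder, ?_⟩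
  have hut : ContDiff ℝ 1 (fun x => fderiv ℝ U (x, t) (0, 1)) :=
    ((contDiff_timeDeriv hU).comp (f := fun x => (x, t)) (by fun_prop)).of_le (by simp)
  obtain ⟨i1, z1⟩ := integral_divergence_eq_zero
    (F := fun y => (fderiv ℝ U (y, t) (0, 1) * heatCutoff ρ (y, t) ^ 3) •
        conormal (fun y => U (y, t)) y)
    ((hut.mul (contDiff_heatCutoff_slice_pow 1 t)).smul
      ((contDiff_conormal hU t).of_le (by simp)))
    (hasCompactSupport_smul_heatCutoff hρ ht.le (fun x hx => by simp [hx]) _)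
  obtain ⟨i2, z2⟩ := integral_divergence_eq_zero
    (F := fun y => (6 * heatCutoff ρ (y, t) ^ 2) • positionField (fun y => U (y, t)) y)
    ((contDiff_const.mul (contDiff_heatCutoff_slice_pow 0 t)).smul
      ((contDiff_positionField hU t).of_le (by simp)))
    (hasCompactSupport_smul_heatCutoff hρ ht.le (fun x hx => by simp [hx]) _)
  have i3 := integrable_localizedCurvature hU hρ ht.le
  have := integral_mono hint ((i1.sub i2).sub i3)
    fun x => localized_first_variation hU (hflow x)
  refine this.trans_eq ?_
  rw [integral_sub' (i1.sub i2) i3, integral_sub' i1 i2, z1, z2, localizedCurvature]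
  ring

/-- Expanding `div (u φ³ N)` and using `⟨du, N⟩ = v - 1/v` gives `φ³ v = div (u φ³ N) + φ³ / v + 6 u
φ² ⟨x, N⟩ - φ³ u div N`. The first term integrates to zero and the others are estimated one by one.
-/
theorem localized_area_density_le (hU : ContDiff ℝ ∞ U) (hρ : 0 < ρ) {m l : ℝ} (hm0 : 0 ≤ m) (hl : 0 < l)
    {x : EuclideanSpace ℝ (Fin n)} {t : ℝ} (ht : 0 ≤ t)
    (hm : 0 < heatCutoff ρ (x, t) → |U (x, t)| ≤ m)
    (hflow : 0 < heatCutoff ρ (x, t) → fderiv ℝ U (x, t) (0, 1) =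
      volumeElement (fun y => U (y, t)) x * divergence (conormal fun y => U (y, t)) x) :
    heatCutoff ρ (x, t) ^ 3 * volumeElement (fun y => U (y, t)) x ≤
      divergence (fun y => (U (y, t) * heatCutoff ρ (y, t) ^ 3) •
        conormal (fun y => U (y, t)) y) x +
      (Metric.closedBall 0 ρ).indicator
        (fun _ => ρ ^ 6 + 6 * m * ρ ^ 5 + l * m ^ 2 * ρ ^ 6 / 2) x +
      (2 * l)⁻¹ * (heatCutoff ρ (x, t) ^ 3 *
        (fderiv ℝ U (x, t) (0, 1) ^ 2 / volumeElement (fun y => U (y, t)) x)) := by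
  have hv := one_le_volumeElement (fun y => U (y, t)) x
  have hw : ContDiffAt ℝ 2 (fun y => U (y, t)) x :=
    (contDiff_slice hU t).contDiffAt.of_le (WithTop.coe_le_coe.2 le_top)
  have hUd := (hw.differentiableAt (by norm_num)).hasFDerivAt
  have h3 : HasFDerivAt (fun y => heatCutoff ρ (y, t) ^ 3) _ x := hasFDerivAt_heatCutoff_pow 1 x t
  rw [divergence_smul (hUd.fun_mul h3) (differentiableAt_conormal hw)]
  simp only [add_apply, smul_apply, innerSL_apply_apply, smul_eq_mul, ← inner_gradient_left]
  have hC : 0 ≤ ρ ^ 6 + 6 * m * ρ ^ 5 + l * m ^ 2 * ρ ^ 6 / 2 := by positivity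
  rcases (heatCutoff_nonneg (ρ := ρ) (x, t)).eq_or_lt with h | h
  · have := Set.indicator_nonneg (s := Metric.closedBall 0 ρ) (fun _ _ => hC) x
    simpa [← h] using this
  rw [hflow h]
  have hx := norm_le_of_heatCutoff_pos hρ ht h
  rw [Set.indicator_of_mem (by simpa using hx)]
  have hPN : inner ℝ (gradient (fun y => U (y, t)) x) (conormal (fun y => U (y, t)) x) =
      volumeElement (fun y => U (y, t)) x - (volumeElement (fun y => U (y, t)) x)⁻¹ := by
    rw [conormal, real_inner_smul_right, real_inner_self_eq_norm_sq]
    have := volumeElement_sq (fun y => U (y, t)) x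
    field_simp
    linarith
  have hb : |inner ℝ x (conormal (fun y => U (y, t)) x)| ≤ ρ :=
    (abs_real_inner_le_norm _ _).trans ((mul_le_of_le_one_right (norm_nonneg _)
      (norm_conormal_le_one _ x)).trans hx)
  have hfρ := heatCutoff_le (ρ := ρ) (z := (x, t)) ht
  have hUm := hm h
  rw [hPN]
  set f := heatCutoff ρ (x, t)
  set v := volumeElement (fun y => U (y, t)) x
  set b := inner ℝ x (conormal (fun y => U (y, t)) x)
  set d := divergence (conormal fun y => U (y, t)) x
  set a := U (x, t)
  have e : (v * d) ^ 2 / v = v * d ^ 2 := by field_simp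
  rw [e]
  have hf3 : f ^ 3 ≤ ρ ^ 6 := (pow_le_pow_left₀ h.le hfρ 3).trans_eq (by ring)
  have hf2 : f ^ 2 ≤ ρ ^ 4 := (pow_le_pow_left₀ h.le hfρ 2).trans_eq (by ring)
  have h1 : f ^ 3 * v⁻¹ ≤ ρ ^ 6 :=
    (mul_le_of_le_one_right (by positivity) (inv_le_one_of_one_le₀ hv)).trans hf3
  have h2 : a * b * f ^ 2 ≤ m * ρ * ρ ^ 4 := by
    have hab : a * b ≤ m * ρ := (le_abs_self _).trans
      ((abs_mul a b).trans_le (mul_le_mul hUm hb (abs_nonneg _) hm0))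
    exact mul_le_mul hab hf2 (by positivity) (by positivity)
  -- Young's inequality with parameter `l`; then `1 ≤ v` turns `d²` into the curvature density `v
  -- d²`.
  have h3 : -(a * d) ≤ l * m ^ 2 / 2 + (2 * l)⁻¹ * (v * d ^ 2) := by
    have ha : a ^ 2 ≤ m ^ 2 := sq_le_sq' (abs_le.1 hUm).1 (abs_le.1 hUm).2
    have h4 : -(a * d) ≤ l * a ^ 2 / 2 + (2 * l)⁻¹ * d ^ 2 := by
      have : l * a ^ 2 / 2 + (2 * l)⁻¹ * d ^ 2 + a * d = (2 * l)⁻¹ * (l * a + d) ^ 2 := by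
        field_simp
        ring
      have : 0 ≤ (2 * l)⁻¹ * (l * a + d) ^ 2 := by positivity
      linarith
    have h5 : (2 * l)⁻¹ * d ^ 2 ≤ (2 * l)⁻¹ * (v * d ^ 2) :=
      mul_le_mul_of_nonneg_left (le_mul_of_one_le_left (sq_nonneg d) hv) (by positivity)
    nlinarith
  have h6 : f ^ 3 * (l * m ^ 2 / 2) ≤ ρ ^ 6 * (l * m ^ 2 / 2) :=
    mul_le_mul_of_nonneg_right hf3 (by positivity)
  have h7 := mul_le_mul_of_nonneg_left h3 (pow_nonneg h.le 3)
  push_cast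
  ring_nf at h1 h2 h6 h7 ⊢
  linarith

theorem localizedArea_le (hU : ContDiff ℝ ∞ U) (hρ : 0 < ρ) {m l : ℝ} (hm0 : 0 ≤ m)
    (hl : 0 < l) {t : ℝ} (ht : 0 ≤ t) (hm : ∀ x, 0 < heatCutoff ρ (x, t) → |U (x, t)| ≤ m)
    (hflow : ∀ x, 0 < heatCutoff ρ (x, t) → fderiv ℝ U (x, t) (0, 1) =
      volumeElement (fun y => U (y, t)) x * divergence (conormal fun y => U (y, t)) x) :
    localizedArea ρ U t ≤
      volume.real (Metric.closedBall (0 : EuclideanSpace ℝ (Fin n)) ρ) *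
        (ρ ^ 6 + 6 * m * ρ ^ 5 + l * m ^ 2 * ρ ^ 6 / 2) +
      (2 * l)⁻¹ * localizedCurvature ρ U t := by
  obtain ⟨i1, z1⟩ := integral_divergence_eq_zero
    (F := fun y => (U (y, t) * heatCutoff ρ (y, t) ^ 3) • conormal (fun y => U (y, t)) y)
    ((((contDiff_slice hU t).of_le (by simp)).mul (contDiff_heatCutoff_slice_pow 1 t)).smul
      ((contDiff_conormal hU t).of_le (by simp)))
    (hasCompactSupport_smul_heatCutoff hρ ht (fun x hx => by simp [hx]) _)
  have i2 : Integrable ((Metric.closedBall (0 : EuclideanSpace ℝ (Fin n)) ρ).indicator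
        (fun _ => ρ ^ 6 + 6 * m * ρ ^ 5 + l * m ^ 2 * ρ ^ 6 / 2)) :=
    (integrable_indicator_iff measurableSet_closedBall).2
      (integrableOn_const (isCompact_closedBall _ _).measure_lt_top.ne)
  have i3 := (integrable_localizedCurvature hU hρ ht).const_mul (2 * l)⁻¹
  have := integral_mono (integrable_localizedArea hU hρ ht) ((i1.add i2).add i3)
    fun x => localized_area_density_le hU hρ hm0 hl ht (hm x) (hflow x)
  refine this.trans_eq ?_
  rw [integral_add' (i1.add i2) i3, integral_add' i1 i2, z1,
    integral_indicator measurableSet_closedBall, setIntegral_const, integral_const_mul,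
    localizedCurvature, smul_eq_mul, zero_add]

end Energy

/-! ### The Riccati inequality -/

/-- If `A' ≤ -B` and `A ≤ K + l D + B / (2l)` for all `l > 0`, then `A` obeys a Riccati inequality
above the level `2K`, and so is bounded after time `b - a` independently of its initial value. -/
theorem le_of_riccati {A B : ℝ → ℝ} {a b K D : ℝ} (hab : a < b) (hK : 0 ≤ K) (hD : 0 < D)
    (hA : ∀ t ∈ Set.Icc a b, ∃ A', HasDerivAt A A' t ∧ A' ≤ -B t)
    (hB : ∀ t ∈ Set.Icc a b, 0 ≤ B t)
    (hAB : ∀ t ∈ Set.Icc a b, ∀ l > 0, A t ≤ K + l * D + (2 * l)⁻¹ * B t) :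
    A b ≤ 2 * K + 8 * D / (b - a) := by
  have hq : 0 ≤ 8 * D / (b - a) := div_nonneg (by positivity) (by linarith)
  by_contra! hlt
  have hcont : ContinuousOn A (Set.Icc a b) := fun t ht => by
    obtain ⟨_, h, _⟩ := hA t ht
    exact h.continuousAt.continuousWithinAt
  have hanti : AntitoneOn A (Set.Icc a b) := by
    refine antitoneOn_of_deriv_nonpos (convex_Icc a b) hcont (fun t ht => ?_) fun t ht => ?_ <;>
    obtain ⟨_, h, h'⟩ := hA t (interior_subset ht)
    · exact h.differentiableAt.differentiableWithinAt
    · rw [h.deriv]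
      linarith [hB t (interior_subset ht)]
  have hbig : ∀ t ∈ Set.Icc a b, 2 * K < A t := fun t ht => by
    have := hanti ht (Set.right_mem_Icc.2 hab.le) ht.2
    linarith
  have hpos : ∀ t ∈ Set.Icc a b, 0 < A t := fun t ht => by linarith [hbig t ht]
  have hquad : ∀ t ∈ Set.Icc a b, A t ^ 2 ≤ 8 * D * B t := by
    intro t ht
    have h0 := hpos t ht
    -- With this `l` the term `l D` is `A / 4`, and `K < A / 2`, which leaves at least `A / 4` to be
    -- bounded by `B / (2l)`.
    have h1 := hAB t ht (A t / (4 * D)) (by positivity)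
    have h2 : A t / (4 * D) * D = A t / 4 := by field_simp
    have h3 : (2 * (A t / (4 * D)))⁻¹ * B t = 2 * D * B t / A t := by field_simp; norm_num
    rw [h2, h3] at h1
    have h4 : A t / 4 ≤ 2 * D * B t / A t := by linarith [hbig t ht]
    rw [le_div_iff₀ h0] at h4
    nlinarith
  -- The integrated form of `A' ≤ -A² / (8D)`: since `1 / A` is positive at `a`, it is at least `(b
  -- - a) / (8D)` at `b`.
  have hmono : MonotoneOn (fun t => (A t)⁻¹ - t / (8 * D)) (Set.Icc a b) := by
    have hd : ∀ t ∈ Set.Icc a b, ∃ A', HasDerivAt (fun t => (A t)⁻¹ - t / (8 * D))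
        (-A' / A t ^ 2 - 1 / (8 * D)) t ∧ A' ≤ -B t := fun t ht => by
      obtain ⟨A', h, h'⟩ := hA t ht
      exact ⟨A', (h.fun_inv (hpos t ht).ne').sub ((hasDerivAt_id t).div_const _), h'⟩
    refine monotoneOn_of_deriv_nonneg (convex_Icc a b) (fun t ht => ?_) (fun t ht => ?_)
      fun t ht => ?_
    · obtain ⟨_, h, _⟩ := hd t ht
      exact h.continuousAt.continuousWithinAt
    · obtain ⟨_, h, _⟩ := hd t (interior_subset ht)
      exact h.differentiableAt.differentiableWithinAt
    · have ht' := interior_subset ht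
      obtain ⟨A', h, h'⟩ := hd t ht'
      have h0 := hpos t ht'
      rw [h.deriv, sub_nonneg, div_le_div_iff₀ (by positivity) (by positivity)]
      nlinarith [hquad t ht']
  have h1 := hmono (Set.left_mem_Icc.2 hab.le) (Set.right_mem_Icc.2 hab.le) hab.le
  have h2 := inv_pos.2 (hpos a (Set.left_mem_Icc.2 hab.le))
  have h3 := hpos b (Set.right_mem_Icc.2 hab.le)
  have h4 : (b - a) / (8 * D) ≤ (A b)⁻¹ := by
    rw [sub_div]
    simp only at h1
    linarith
  have h5 : A b ≤ 8 * D / (b - a) := by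
    rw [le_inv_comm₀ (div_pos (by linarith) (by positivity)) h3, inv_div] at h4
    exact h4
  linarith

/-! ### Smooth extension, interior times and passage to the final time -/

open Topology in
-- Multiply by a smooth cutoff equal to one near `K`. Agreement on neighborhoods, not merely on `K`,
-- transfers all derivatives and hence the flow equation.
theorem exists_contDiff_eventuallyEq {E : Type*} [NormedAddCommGroup E] [NormedSpace ℝ E]
    [FiniteDimensional ℝ E] {f : E → ℝ} {Ω K : Set E} (hΩ : IsOpen Ω) (hK : IsCompact K)
    (hKΩ : K ⊆ Ω) (hf : ∀ z ∈ Ω, ContDiffAt ℝ ∞ f z) :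
    ∃ g : E → ℝ, ContDiff ℝ ∞ g ∧ ∀ z ∈ K, g =ᶠ[𝓝 z] f := by
  obtain ⟨L, hL, hKL, hLΩ⟩ := exists_compact_between hK hΩ hKΩ
  obtain ⟨χ, h1, h0, -⟩ := exists_contMDiffMap_one_nhds_of_subset_interior (n := (⊤ : ℕ∞))
    (modelWithCornersSelf ℝ E) hK.isClosed hKL
  have hχ : ContDiff ℝ ∞ χ := χ.contMDiff.contDiff
  refine ⟨fun z => χ z * f z, contDiff_iff_contDiffAt.2 fun z => ?_, fun z hz => ?_⟩
  · by_cases hz : z ∈ Ω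
    · exact hχ.contDiffAt.mul (hf z hz)
    · refine (contDiffAt_const (c := (0 : ℝ))).congr_of_eventuallyEq ?_
      filter_upwards [hL.isClosed.isOpen_compl.mem_nhds fun h => hz (hLΩ h)] with y hy
      rw [h0 y hy, zero_mul]
  · filter_upwards [h1.filter_mono (nhds_le_nhdsSet hz)] with y hy
    rw [hy, one_mul]

open Topology in
theorem volumeElement_congr {n : ℕ} {w w' : EuclideanSpace ℝ (Fin n) → ℝ}
    {x : EuclideanSpace ℝ (Fin n)} (h : w =ᶠ[𝓝 x] w') :
    volumeElement w x = volumeElement w' x := by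
  rw [volumeElement, volumeElement, h.gradient_eq]

open Topology in
theorem divergence_conormal_congr {n : ℕ} {w w' : EuclideanSpace ℝ (Fin n) → ℝ}
    {x : EuclideanSpace ℝ (Fin n)} (h : w =ᶠ[𝓝 x] w') :
    divergence (conormal w) x = divergence (conormal w') x := by
  have : conormal w =ᶠ[𝓝 x] conormal w' := by
    filter_upwards [h.eventuallyEq_nhds] with y hy
    rw [conormal, conormal, volumeElement_congr hy, hy.gradient_eq]
  rw [divergence, divergence, this.fderiv_eq]

theorem measurable_volumeElement {n : ℕ} (w : EuclideanSpace ℝ (Fin n) → ℝ) :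
    Measurable (volumeElement w) := by
  have : volumeElement w = fun x => √(1 + ‖fderiv ℝ w x‖ ^ 2) := by
    ext x
    rw [volumeElement, gradient, LinearIsometryEquiv.norm_map]
  rw [this]
  exact ((((measurable_fderiv ℝ w).norm).pow_const 2).const_add 1).sqrt

open MeasureTheory in
theorem graphArea_le_localizedArea {n : ℕ} {U : EuclideanSpace ℝ (Fin n) × ℝ → ℝ} {ρ σ t : ℝ}
    (hU : ContDiff ℝ ∞ U) (hρ : 0 < ρ) (ht : 0 ≤ t) (hσ : 0 < σ)
    {Ω : Set (EuclideanSpace ℝ (Fin n))} (hΩ : MeasurableSet Ω)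
    (hΩσ : ∀ x ∈ Ω, σ ≤ heatCutoff ρ (x, t)) :
    graphArea (fun y => U (y, t)) Ω ≤ ENNReal.ofReal ((σ ^ 3)⁻¹ * localizedArea ρ U t) := by
  have hi := (integrable_localizedArea hU hρ ht).const_mul (σ ^ 3)⁻¹
  have hnn : ∀ x : EuclideanSpace ℝ (Fin n), 0 ≤ (σ ^ 3)⁻¹ *
      (heatCutoff ρ (x, t) ^ 3 * volumeElement (fun y => U (y, t)) x) := fun x =>
    mul_nonneg (by positivity) (mul_nonneg (pow_nonneg (heatCutoff_nonneg _) 3)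
      (volumeElement_pos _ _).le)
  rw [localizedArea, ← integral_const_mul,
    ofReal_integral_eq_lintegral_ofReal hi (Filter.Eventually.of_forall hnn), graphArea]
  refine (setLIntegral_mono' hΩ fun x hx => ENNReal.ofReal_le_ofReal ?_).trans
    (setLIntegral_le_lintegral Ω _)
  rw [← mul_assoc]
  refine le_mul_of_one_le_left (volumeElement_pos _ _).le ?_
  rw [inv_mul_eq_div, one_le_div (by positivity)]
  exact pow_le_pow_left₀ hσ.le (hΩσ x hx) 3

open MeasureTheory Topology in
theorem graphArea_congr {n : ℕ} {w w' : EuclideanSpace ℝ (Fin n) → ℝ}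
    {Ω : Set (EuclideanSpace ℝ (Fin n))} (hΩ : MeasurableSet Ω) (h : ∀ x ∈ Ω, w =ᶠ[𝓝 x] w') :
    graphArea w Ω = graphArea w' Ω :=
  setLIntegral_congr_fun hΩ fun x hx => by simp only [volumeElement_congr (h x hx)]

namespace GraphFlowsByMeanCurvature

variable {n : ℕ} {u : EuclideanSpace ℝ (Fin n) → ℝ → ℝ} {R T : ℝ}

open MeasureTheory Topology in
theorem graphArea_le_of_lt (hu : GraphFlowsByMeanCurvature u R T) {ρ M a b σ : ℝ} (hρ : 0 < ρ)
    (hρR : ρ < R) (hM : 0 ≤ M)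
    (h0 : ∀ x ∈ Metric.ball (0 : EuclideanSpace ℝ (Fin n)) R, |u x 0| ≤ M)
    (ha : 0 < a) (hab : a < b) (hbT : b < T) (hσ : 0 < σ)
    {Ω : Set (EuclideanSpace ℝ (Fin n))} (hΩ : MeasurableSet Ω)
    (hΩσ : ∀ x ∈ Ω, σ ≤ heatCutoff ρ (x, b)) :
    graphArea (fun x => u x b) Ω ≤ ENNReal.ofReal ((σ ^ 3)⁻¹ *
      (2 * (volume.real (Metric.closedBall (0 : EuclideanSpace ℝ (Fin n)) ρ) *
          (ρ ^ 6 + 6 * (M + ρ) * ρ ^ 5)) +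
        8 * (volume.real (Metric.closedBall (0 : EuclideanSpace ℝ (Fin n)) ρ) *
          ((M + ρ) ^ 2 * ρ ^ 6 / 2)) / (b - a))) := by
  have hsub : Metric.closedBall (0 : EuclideanSpace ℝ (Fin n)) ρ ⊆ Metric.ball 0 R :=
    Metric.closedBall_subset_ball hρR
  obtain ⟨U, hU, hUu⟩ := exists_contDiff_eventuallyEq
    (f := fun p : EuclideanSpace ℝ (Fin n) × ℝ => u p.1 p.2)
    (Ω := Metric.ball 0 R ×ˢ Set.Ioo 0 T) (K := Metric.closedBall 0 ρ ×ˢ Set.Icc a b)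
    (Metric.isOpen_ball.prod isOpen_Ioo) ((isCompact_closedBall _ _).prod isCompact_Icc)
    (Set.prod_mono hsub fun t ht => ⟨ha.trans_le ht.1, ht.2.trans_lt hbT⟩)
    fun z hz => hu.contDiffAt hz.1 hz.2
  have hslice : ∀ t ∈ Set.Icc a b, ∀ x ∈ Metric.closedBall (0 : EuclideanSpace ℝ (Fin n)) ρ,
      (fun y => U (y, t)) =ᶠ[𝓝 x] fun y => u y t := fun t ht x hx =>
    (Continuous.tendsto (by fun_prop : Continuous fun y : EuclideanSpace ℝ (Fin n) => (y, t))
      x).eventually (hUu (x, t) ⟨hx, ht⟩)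
  have hmem : ∀ t, 0 ≤ t → ∀ x : EuclideanSpace ℝ (Fin n), 0 < heatCutoff ρ (x, t) →
      x ∈ Metric.closedBall 0 ρ := fun t ht x hx => by
    simpa using norm_le_of_heatCutoff_pos hρ ht hx
  have hflow : ∀ t ∈ Set.Icc a b, ∀ x : EuclideanSpace ℝ (Fin n), 0 < heatCutoff ρ (x, t) →
      fderiv ℝ U (x, t) (0, 1) = volumeElement (fun y => U (y, t)) x *
        divergence (conormal fun y => U (y, t)) x := by
    intro t ht x hx
    have hxm := hmem t (ha.le.trans ht.1) x hx
    have hs := hslice t ht x hxm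
    rw [volumeElement_congr hs, divergence_conormal_congr hs]
    have h1 := hu.hasDerivAt (hsub hxm) ⟨ha.trans_le ht.1, ht.2.trans_lt hbT⟩
    have h2 := (hU.differentiable (by simp) (x, t)).hasFDerivAt.comp_hasDerivAt t
      ((hasDerivAt_const t x).prodMk (hasDerivAt_id t))
    refine h2.unique (h1.congr_of_eventuallyEq ?_)
    exact (Continuous.tendsto (by fun_prop : Continuous fun s : ℝ => (x, s)) t).eventually
      (hUu (x, t) ⟨hxm, ht⟩)
  have hbound : ∀ t ∈ Set.Icc a b, ∀ x : EuclideanSpace ℝ (Fin n), 0 < heatCutoff ρ (x, t) →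
      |U (x, t)| ≤ M + ρ := by
    intro t ht x hx
    rw [(hUu (x, t) ⟨hmem t (ha.le.trans ht.1) x hx, ht⟩).eq_of_nhds]
    exact hu.abs_apply_le hρ hρR h0 ⟨ha.le.trans ht.1, ht.2.trans_lt hbT⟩
      ((heatCutoff_pos_iff _).1 hx)
  have hV : 0 < volume.real (Metric.closedBall (0 : EuclideanSpace ℝ (Fin n)) ρ) :=
    ENNReal.toReal_pos (Metric.measure_closedBall_pos _ _ hρ).ne'
      (isCompact_closedBall _ _).measure_lt_top.ne
  have hA := le_of_riccati (A := localizedArea ρ U) (B := localizedCurvature ρ U)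
    (K := volume.real (Metric.closedBall (0 : EuclideanSpace ℝ (Fin n)) ρ) *
          (ρ ^ 6 + 6 * (M + ρ) * ρ ^ 5))
    (D := volume.real (Metric.closedBall (0 : EuclideanSpace ℝ (Fin n)) ρ) *
          ((M + ρ) ^ 2 * ρ ^ 6 / 2)) hab (by positivity) (by positivity)
    (fun t ht => exists_hasDerivAt_localizedArea hU hρ (ha.trans_le ht.1) (hflow t ht))
    (fun t ht => integral_nonneg fun x => mul_nonneg (pow_nonneg (heatCutoff_nonneg _) 3)
      (div_nonneg (sq_nonneg _) (volumeElement_pos _ _).le))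
    (fun t ht l hl => (localizedArea_le hU hρ (by positivity) hl (ha.le.trans ht.1)
      (hbound t ht) (hflow t ht)).trans_eq (by ring))
  have hb : b ∈ Set.Icc a b := Set.right_mem_Icc.2 hab.le
  have hb0 : 0 ≤ b := (ha.trans hab).le
  rw [← graphArea_congr hΩ fun x hx => hslice b hb x
    (hmem b hb0 x (hσ.trans_le (hΩσ x hx)))]
  refine (graphArea_le_localizedArea hU hρ hb0 hσ hΩ hΩσ).trans (ENNReal.ofReal_le_ofReal ?_)
  exact mul_le_mul_of_nonneg_left hA (by positivity)

open Topology in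
-- At the end times `u` is smooth only in the one-sided sense. The spatial gradient is still the
-- restriction of the derivative within the space-time cylinder, which is continuous up to those
-- times.
theorem continuousOn_volumeElement (hu : GraphFlowsByMeanCurvature u R T) (hT : 0 < T)
    {x : EuclideanSpace ℝ (Fin n)} (hx : x ∈ Metric.ball 0 R) :
    ContinuousOn (fun t => volumeElement (fun y => u y t) x) (Set.Icc 0 T) := by
  set S : Set (EuclideanSpace ℝ (Fin n) × ℝ) := Metric.ball 0 R ×ˢ Set.Icc 0 T
  set f : EuclideanSpace ℝ (Fin n) × ℝ → ℝ := fun p => u p.1 p.2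
  have hS : UniqueDiffOn ℝ S := Metric.isOpen_ball.uniqueDiffOn.prod (uniqueDiffOn_Icc hT)
  have hd : ∀ t ∈ Set.Icc 0 T, fderiv ℝ (fun y => u y t) x =
      (fderivWithin ℝ f S (x, t)).comp (ContinuousLinearMap.inl ℝ _ ℝ) := by
    intro t ht
    have h1 : HasFDerivWithinAt f (fderivWithin ℝ f S (x, t)) S (x, t) :=
      (hu.smooth.differentiableOn (by simp) (x, t) ⟨hx, ht⟩).hasFDerivWithinAt
    have h2 := h1.comp (f := fun y => (y, t)) (s := Metric.ball 0 R) x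
      (hasFDerivAt_prodMk_left x t).hasFDerivWithinAt fun y hy => ⟨hy, ht⟩
    exact (h2.hasFDerivAt (Metric.isOpen_ball.mem_nhds hx)).fderiv
  have hc : ContinuousOn (fun t => fderiv ℝ (fun y => u y t) x) (Set.Icc 0 T) := by
    refine ContinuousOn.congr ?_ hd
    have h1 := (hu.smooth.continuousOn_fderivWithin hS (by simp)).comp
      (f := fun t : ℝ => (x, t)) (s := Set.Icc 0 T) (by fun_prop) fun t ht => ⟨hx, ht⟩
    exact h1.clm_comp continuousOn_const
  have : (fun t => volumeElement (fun y => u y t) x) =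
      fun t => √(1 + ‖fderiv ℝ (fun y => u y t) x‖ ^ 2) := by
    ext t
    rw [volumeElement, gradient, LinearIsometryEquiv.norm_map]
  rw [this]
  exact ((hc.norm.pow 2).const_add 1).sqrt

open MeasureTheory Filter Topology in
-- Fatou's lemma along times increasing to `T`, with pointwise convergence of the volume element.
theorem graphArea_final_le (hu : GraphFlowsByMeanCurvature u R T) (hT : 0 < T)
    {Ω : Set (EuclideanSpace ℝ (Fin n))} (hΩ : MeasurableSet Ω) (hΩR : Ω ⊆ Metric.ball 0 R)
    {c : ENNReal} {a : ℝ} (ha0 : 0 ≤ a) (ha : a < T)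
    (h : ∀ b ∈ Set.Ioo a T, graphArea (fun x => u x b) Ω ≤ c) :
    graphArea (fun x => u x T) Ω ≤ c := by
  obtain ⟨b, -, hb, hbT⟩ := exists_seq_strictMono_tendsto' ha
  have hlim : ∀ x ∈ Ω, Tendsto (fun k => ENNReal.ofReal (volumeElement (fun y => u y (b k)) x))
      atTop (𝓝 (ENNReal.ofReal (volumeElement (fun y => u y T) x))) := fun x hx =>
    (ENNReal.continuous_ofReal.tendsto _).comp
      ((hu.continuousOn_volumeElement hT (hΩR hx) T ⟨hT.le, le_rfl⟩).tendsto.comp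
        (tendsto_nhdsWithin_iff.2 ⟨hbT, Eventually.of_forall fun k =>
          ⟨ha0.trans (hb k).1.le, (hb k).2.le⟩⟩))
  calc graphArea (fun x => u x T) Ω
      = ∫⁻ x in Ω, liminf (fun k => ENNReal.ofReal (volumeElement (fun y => u y (b k)) x)) atTop :=
        setLIntegral_congr_fun hΩ fun x hx => (hlim x hx).liminf_eq.symm
    _ ≤ liminf (fun k => graphArea (fun y => u y (b k)) Ω) atTop :=
        lintegral_liminf_le fun k => (measurable_volumeElement _).ennreal_ofReal
    _ ≤ c := liminf_le_of_frequently_le' (Frequently.of_forall fun k => h _ (hb k))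

end GraphFlowsByMeanCurvature

/-! ### The constant and the conclusion -/

open MeasureTheory in
-- Here `b` is the length of the time window. The constant is `176 = 8 (2 · 7 + 8)`: the factor 8 is
-- from `(r² / 2)⁻³`, and the summands are from the `K` and `D` terms.
theorem area_constant_le {n : ℕ} {r ρ M b : ℝ} (hr : 0 < r) (hρ : 0 < ρ)
    (hρr : ρ ≤ (2 * n + 1) * r) (hM : 0 ≤ M) (hb : r ^ 2 / 2 ≤ b) :
    ((r ^ 2 / 2) ^ 3)⁻¹ *
      (2 * (volume.real (Metric.closedBall (0 : EuclideanSpace ℝ (Fin n)) ρ) *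
          (ρ ^ 6 + 6 * (M + ρ) * ρ ^ 5)) +
        8 * (volume.real (Metric.closedBall (0 : EuclideanSpace ℝ (Fin n)) ρ) *
          ((M + ρ) ^ 2 * ρ ^ 6 / 2)) / b) ≤
      176 * (2 * n + 1) ^ (n + 8) *
        volume.real (Metric.ball (0 : EuclideanSpace ℝ (Fin n)) 1) * r ^ n *
        (1 + r⁻¹ * M) ^ 2 := by
  set V := volume.real (Metric.ball (0 : EuclideanSpace ℝ (Fin n)) 1)
  have hV : 0 ≤ V := measureReal_nonneg
  rw [Measure.addHaar_real_closedBall _ _ hρ.le, finrank_euclideanSpace_fin]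
  change _ * (2 * (ρ ^ n * V * _) + 8 * (ρ ^ n * V * _) / b) ≤ _
  set c : ℝ := 2 * n + 1
  set q : ℝ := 1 + r⁻¹ * M
  have hc : 1 ≤ c := by simp only [c]; linarith [n.cast_nonneg (α := ℝ)]
  have hq : 1 ≤ q := le_add_of_nonneg_right (by positivity)
  have hm : M + ρ ≤ c * r * q := by
    have : c * r * q = c * r + c * M := by simp only [q]; field_simp
    rw [this]
    nlinarith
  have h1 : ρ ^ n * V ≤ (c * r) ^ n * V :=
    mul_le_mul_of_nonneg_right (pow_le_pow_left₀ hρ.le hρr n) hV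
  have h2 : ρ ^ 6 + 6 * (M + ρ) * ρ ^ 5 ≤ 7 * ((c * r) ^ 6 * q) := by
    have h3 : ρ ^ 6 ≤ (c * r) ^ 6 * q :=
      (pow_le_pow_left₀ hρ.le hρr 6).trans (le_mul_of_one_le_right (by positivity) hq)
    have h4 : (M + ρ) * ρ ^ 5 ≤ (c * r * q) * (c * r) ^ 5 :=
      mul_le_mul hm (pow_le_pow_left₀ hρ.le hρr 5) (by positivity) (by positivity)
    linarith [show c * r * q * (c * r) ^ 5 = (c * r) ^ 6 * q by ring]
  have h3 : (M + ρ) ^ 2 * ρ ^ 6 / 2 ≤ (c * r * q) ^ 2 * (c * r) ^ 6 / 2 := by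
    have := mul_le_mul (pow_le_pow_left₀ (by positivity) hm 2)
      (pow_le_pow_left₀ hρ.le hρr 6) (by positivity) (by positivity)
    linarith
  have h4 : 8 * (ρ ^ n * V * ((M + ρ) ^ 2 * ρ ^ 6 / 2)) / b ≤
      8 * ((c * r) ^ n * V * ((c * r * q) ^ 2 * (c * r) ^ 6 / 2)) / (r ^ 2 / 2) := by gcongr
  have h5 : 7 * ((c * r) ^ 6 * q) ≤ 7 * (c ^ 8 * r ^ 6 * q ^ 2) := by
    have : c ^ 6 * q ≤ c ^ 8 * q ^ 2 :=
      mul_le_mul (pow_le_pow_right₀ hc (by norm_num)) (le_self_pow₀ hq (by norm_num))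
        (by positivity) (by positivity)
    nlinarith [pow_pos hr 6]
  calc _ ≤ ((r ^ 2 / 2) ^ 3)⁻¹ * (2 * ((c * r) ^ n * V * (7 * (c ^ 8 * r ^ 6 * q ^ 2))) +
        8 * ((c * r) ^ n * V * ((c * r * q) ^ 2 * (c * r) ^ 6 / 2)) / (r ^ 2 / 2)) := by
        gcongr
        exact h2.trans h5
    _ = _ := by
        rw [mul_pow, pow_add]
        field_simp
        ring

theorem theorem3p1 (n : ℕ) :
    ∃ C : ℝ, 0 < C ∧
      ∀ (r : ℝ) (u : EuclideanSpace ℝ (Fin n) → ℝ → ℝ), 0 < r →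
        GraphFlowsByMeanCurvature u (√(2 * n + 1) * r) (r ^ 2) →
          graphArea (fun x => u x (r ^ 2)) (Metric.ball 0 (r / 2)) ≤
            ENNReal.ofReal (C * r ^ n) *
              (1 + ENNReal.ofReal r⁻¹ *
                supNorm (fun x => u x 0) (Metric.ball 0 (√(2 * n + 1) * r))) ^ 2 := by
  have hV : 0 < MeasureTheory.volume.real (Metric.ball (0 : EuclideanSpace ℝ (Fin n)) 1) :=
    ENNReal.toReal_pos (Metric.measure_ball_pos _ _ one_pos).ne' MeasureTheory.measure_ball_ne_top
  refine ⟨176 * (2 * n + 1) ^ (n + 8) *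
    MeasureTheory.volume.real (Metric.ball (0 : EuclideanSpace ℝ (Fin n)) 1), by positivity, ?_⟩
  intro r u hr hu
  have hn : (0 : ℝ) ≤ n := n.cast_nonneg
  set s := supNorm (fun x => u x 0) (Metric.ball 0 (√(2 * n + 1) * r))
  by_cases htop : s = ⊤
  · have h1 : ENNReal.ofReal r⁻¹ ≠ 0 := by simpa using hr
    have h2 : ENNReal.ofReal (176 * (2 * n + 1) ^ (n + 8) *
        MeasureTheory.volume.real (Metric.ball (0 : EuclideanSpace ℝ (Fin n)) 1) * r ^ n) ≠ 0 := by
      simp only [ne_eq, ENNReal.ofReal_eq_zero, not_le]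
      positivity
    rw [htop, ENNReal.mul_top h1, add_top, ENNReal.top_pow two_ne_zero, ENNReal.mul_top h2]
    exact le_top
  have hM : ∀ x ∈ Metric.ball (0 : EuclideanSpace ℝ (Fin n)) (√(2 * n + 1) * r),
      |u x 0| ≤ s.toReal := fun x hx => by
    have : ENNReal.ofReal |u x 0| ≤ s := le_iSup₂_of_le x hx le_rfl
    exact (ENNReal.ofReal_le_iff_le_toReal htop).1 this
  have hR2 : (√(2 * n + 1) * r) ^ 2 = (2 * n + 1) * r ^ 2 := by
    rw [mul_pow, Real.sq_sqrt (by positivity)]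
  -- For `|x| < r / 2` and `t ≤ r²` this leaves `ρ² - |x|² - 2nt ≥ r² / 2`, while `ρ` stays strictly
  -- below the given radius.
  set ρ := √((2 * n + 1) * r ^ 2 - r ^ 2 / 4)
  have hpos : 0 < (2 * n + 1) * r ^ 2 - r ^ 2 / 4 := by nlinarith [pow_pos hr 2]
  have hρ : 0 < ρ := Real.sqrt_pos.2 hpos
  have hρ2 : ρ ^ 2 = (2 * n + 1) * r ^ 2 - r ^ 2 / 4 := Real.sq_sqrt hpos.le
  have hρR : ρ < √(2 * n + 1) * r := by
    refine lt_of_pow_lt_pow_left₀ 2 (by positivity) ?_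
    rw [hρ2, hR2]
    linarith [pow_pos hr 2]
  have hρr : ρ ≤ (2 * n + 1) * r := hρR.le.trans (mul_le_mul_of_nonneg_right
    (Real.sqrt_le_iff.2 ⟨by linarith, by nlinarith⟩) hr.le)
  have hsub : Metric.ball (0 : EuclideanSpace ℝ (Fin n)) (r / 2) ⊆
      Metric.ball 0 (√(2 * n + 1) * r) := by
    refine Metric.ball_subset_ball (le_trans ?_ (le_mul_of_one_le_left hr.le
      (Real.one_le_sqrt.2 (by linarith))))
    linarith
  have hrhs : ENNReal.ofReal (176 * (2 * n + 1) ^ (n + 8) *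
      MeasureTheory.volume.real (Metric.ball (0 : EuclideanSpace ℝ (Fin n)) 1) * r ^ n) *
        (1 + ENNReal.ofReal r⁻¹ * s) ^ 2 = ENNReal.ofReal (176 * (2 * n + 1) ^ (n + 8) *
      MeasureTheory.volume.real (Metric.ball (0 : EuclideanSpace ℝ (Fin n)) 1) * r ^ n *
        (1 + r⁻¹ * s.toReal) ^ 2) := by
    rw [ENNReal.ofReal_mul (q := (1 + r⁻¹ * s.toReal) ^ 2) (by positivity),
      ENNReal.ofReal_pow (p := 1 + r⁻¹ * s.toReal) (by positivity),
      ENNReal.ofReal_add zero_le_one (by positivity), ENNReal.ofReal_one,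
      ENNReal.ofReal_mul (p := r⁻¹) (by positivity), ENNReal.ofReal_toReal htop]
  rw [hrhs]
  -- Final times `b` in `(3r² / 4, r²)` and initial time `r² / 4` give the Riccati argument a window
  -- of length at least `r² / 2`, away from both end times.
  refine hu.graphArea_final_le (by positivity) measurableSet_ball hsub
    (a := 3 * r ^ 2 / 4) (by positivity) (by linarith [pow_pos hr 2]) fun b hb => ?_
  refine (hu.graphArea_le_of_lt (a := r ^ 2 / 4) (σ := r ^ 2 / 2) hρ hρR
    ENNReal.toReal_nonneg hM (by positivity) (by linarith [hb.1, pow_pos hr 2]) hb.2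
    (by positivity) measurableSet_ball fun x hx => ?_).trans (ENNReal.ofReal_le_ofReal
      (area_constant_le hr hρ hρr ENNReal.toReal_nonneg (by linarith [hb.1])))
  refine le_max_of_le_left ?_
  rw [hρ2]
  have hx' : ‖x‖ ^ 2 ≤ (r / 2) ^ 2 :=
    pow_le_pow_left₀ (norm_nonneg _) (mem_ball_zero_iff.1 hx).le 2
  have := mul_le_mul_of_nonneg_left hb.2.le hn
  simp only
  nlinarith
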